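/- For real numbers $0<\beta<\alpha<1$ let $T=T_{\alpha,\beta}:[0,1)\to[0,1)$ be the interval translation map $$T(x)=\begin{cases}x+\alpha, & x\in B_1=[0,1-\alpha),\\ x+\beta, & x\in B_2=[1-\alpha,1-\beta),\\ x+\beta-1, & x\in B_3=[1-\beta,1).\end{cases}$$ Put $\Omega_0=[0,1)$ and $\Omega_{n+1}=T(\Omega_n)$. Call $T$ of finite type if $\Omega_n=\Omega_{n+1}$ for some $n$, of infinite type otherwise, and aperiodic if it has no periodic point. Let $G(\alpha,\beta)=\bigl(\tfrac{\beta}{\alpha},\tfrac{\beta-1}{\alpha}+\lfloor\tfrac1\alpha\rfloor\bigr)$, $(\alpha_i,\beta_i)=G^i(\alpha,\beta)$ and $k_i=\lfloor 1/\alpha_i\rfloor$ for $i\ge 0$. Let $\tilde S=\{(\xi,\eta)\in\mathbb R^2:\xi\le 1,\ \eta\le 1,\ \xi+\eta\ge 1\}$, $$\tilde F_k(\xi,\eta)=\Bigl(1-\frac{\eta}{k\eta+\xi},\ \frac{1}{k\eta+\xi}\Bigr),\qquad Z_0=\bigcap_{i\ge 0}\tilde F_{k_0}\circ\tilde F_{k_1}\circ\cdots\circ\tilde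 F_{k_i}(\tilde S).$$ (1) If $T$ is aperiodic or of infinite type, then $T$ has at most two ergodic invariant Borel probability measures. (2) If $T$ is of infinite type, then the convex set $Z_0$ has at most two extreme points, and $$\mu\longmapsto\bigl(\mu(B_1)+\mu(B_2),\ \mu(B_2)+\mu(B_3)\bigr)$$ is a bijection from the set of ergodic $T$-invariant Borel probability measures onto the set of extreme points of $Z_0$. -/

import Mathlib

open Set MeasureTheory

noncomputable section

namespace TranslationMap

/-- The phase space `I = [0,1)`. -/
abbrev I : Type := Ico (0 : ℝ) 1

/-- The open parameter triangle `0 < β < α < 1`, with `p = (α, β)`. -/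
def paramRegion : Set (ℝ × ℝ) := {p | 0 < p.2 ∧ p.2 < p.1 ∧ p.1 < 1}

/-- The formula of the map with parameters `(α, β)`; it is only used on `[0,1)`. -/
def mapFormula (p : ℝ × ℝ) (x : ℝ) : ℝ :=
  if x < 1 - p.1 then x + p.1
  else if x < 1 - p.2 then x + p.2
  else x + p.2 - 1

theorem mapFormula_mapsTo {p : ℝ × ℝ} (hp : p ∈ paramRegion) :
    MapsTo (mapFormula p) (Ico 0 1) (Ico 0 1) := by
  obtain ⟨h1, h2, h3⟩ := hp
  rintro x ⟨hx0, hx1⟩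
  unfold mapFormula
  split_ifs <;> constructor <;> linarith

/-- The interval translation map `T : [0,1) → [0,1)` with parameters `p = (α, β)`. -/
def itm (p : ℝ × ℝ) (hp : p ∈ paramRegion) : I → I :=
  (mapFormula_mapsTo hp).restrict

/-- `Ω₀ = [0,1)` and `Ωₙ₊₁ = T(Ωₙ)`. -/
def omega (T : I → I) : ℕ → Set I
  | 0 => univ
  | n + 1 => T '' omega T n

/-- `T` is of finite type if the decreasing sequence `Ωₙ` stabilizes. -/
def IsFiniteType (T : I → I) : Prop := ∃ n, omega T n = omega T (n + 1)

/-- `T` has no periodic point. -/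
def IsAperiodic (T : I → I) : Prop := Function.periodicPts T = ∅

/-- The set of ergodic `T`-invariant Borel probability measures on `[0,1)`. -/
def ergodicMeasures (T : I → I) : Set (Measure I) :=
  {μ | IsProbabilityMeasure μ ∧ Ergodic T μ}

/-- The Gauss map `G(α, β) = (β/α, (β-1)/α + ⌊1/α⌋)`. -/
def gauss (p : ℝ × ℝ) : ℝ × ℝ :=
  (p.2 / p.1, (p.2 - 1) / p.1 + (⌊1 / p.1⌋₊ : ℝ))

/-- `kᵢ = ⌊1/αᵢ⌋`, where `(αᵢ, βᵢ) = Gⁱ(α, β)`. -/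
def code (p : ℝ × ℝ) (i : ℕ) : ℕ := ⌊1 / (gauss^[i] p).1⌋₊

/-- The simplex of letter frequencies `(x, y, z)`, in the coordinates
`ξ = x + y`, `η = y + z`. -/
def freqTriangle : Set (ℝ × ℝ) := {q | q.1 ≤ 1 ∧ q.2 ≤ 1 ∧ 1 ≤ q.1 + q.2}

/-- The action on letter frequencies, in the coordinates `(ξ, η)`, of the substitution
`1 → 2`, `2 → 3 1ᵏ`, `3 → 3 1ᵏ⁻¹`. -/
def freqMap (k : ℕ) (q : ℝ × ℝ) : ℝ × ℝ :=
  (1 - q.2 / (k * q.2 + q.1), 1 / (k * q.2 + q.1))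

/-- The composition of the frequency maps of `k 0, …, k (n - 1)`, that of `k 0` applied last. -/
def freqComp (k : ℕ → ℕ) : ℕ → ℝ × ℝ → ℝ × ℝ
  | 0 => id
  | n + 1 => freqComp k n ∘ freqMap (k n)

/-- The limit frequency set `Z₀`: the limit, that is the intersection, of the decreasing sequence
of triangles obtained as images of `freqTriangle` under the compositions for `k 0, …, k i`. -/
def limitSet (p : ℝ × ℝ) : Set (ℝ × ℝ) :=
  ⋂ i : ℕ, freqComp (code p) (i + 1) '' freqTriangle

/-- The branch domains `B₁ = [0, 1-α)`, `B₂ = [1-α, 1-β)`, `B₃ = [1-β, 1)`. -/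
def branch₁ (p : ℝ × ℝ) : Set I := {x | (x : ℝ) < 1 - p.1}

/-- See `branch₁`. -/
def branch₂ (p : ℝ × ℝ) : Set I := {x | 1 - p.1 ≤ (x : ℝ) ∧ (x : ℝ) < 1 - p.2}

/-- See `branch₁`. -/
def branch₃ (p : ℝ × ℝ) : Set I := {x | 1 - p.2 ≤ (x : ℝ)}

/-- The frequency vector `(μ B₁, μ B₂, μ B₃) = (x, y, z)` of a measure, in the coordinates
`ξ = x + y`, `η = y + z`. -/
def freqVector (p : ℝ × ℝ) (μ : Measure I) : ℝ × ℝ :=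
  (μ.real (branch₁ p) + μ.real (branch₂ p), μ.real (branch₂ p) + μ.real (branch₃ p))

end TranslationMap

end

/-!
The first return map of `T` to `[1 - α, 1)`, rescaled to `[0,1)`, is given by the same formula with
parameters `gauss (α, β)`, and the itinerary of a return is read off the substitution `1 → 2`,
`2 → 3 1ᵏ`, `3 → 3 1ᵏ⁻¹` with `k = ⌊1/α⌋`. By Kac's formula (`eq_lift_comap`) the invariant measures
of `T` are the tower measures over those of the renormalized map, and letter frequencies transform
by `freqMap k`. There are two cases.

If all iterates of `gauss` stay in the parameter triangle (`IsRenormalizable`), then `αᵢ ≤ 1/2` for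
infinitely many `i`, so that the lengths of the return intervals and the masses of the tower bases
tend to zero. Hence
* an invariant measure is determined by its frequency vector (`eq_of_freqVector_eq`): the integral
  of a Lipschitz function is, up to the length of the return interval, determined by the masses of
  the bases, and these are determined by the frequencies;
* every point of the limit set is the frequency vector of an invariant measure
  (`exists_measurePreserving`): measures on the towers of level `n` with the right frequencies are
  invariant up to the mass of the bases; their limit along an ultrafilter is an invariant finitely
  additive probability, and it is given by a measure because short segments, which reach the small
  return intervals before they are cut, have small mass, so that its distribution function is
  continuous;
* three points of the limit set are collinear (`signedArea_eq_zero`), as the areas of the nested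
  triangles are controlled by the masses of the bases.

So `freqVector` is an affine bijection between the simplex of invariant probability measures, whose
extreme points are the ergodic measures, and the limit set, which lies on a line and therefore has
at most two extreme points.

Otherwise some renormalization leaves the triangle. There the map is a translation by `α` modulo
some `L` and has an interval of length `L` as attractor. Attractors are inherited by the original
map, which is therefore of finite type. If there are no periodic points, the map on the attractor is
an irrational rotation and has a unique invariant probability measure; uniqueness is inherited as
well.
-/

noncomputable section

namespace TranslationMap

open Filter Topology
open scoped ENNReal

/-! ### Towers over a return map -/

section Tower

variable {X Y : Type*} {T : X → X} {S : Y → Y} {φ : Y → X} {r : Y → ℕ}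

/-- The sum of `f` along the first `r y` points of the `T`-orbit of `φ y`. -/
def towerSum (T : X → X) (φ : Y → X) (r : Y → ℕ) (f : X → ℝ≥0∞) (y : Y) : ℝ≥0∞ :=
  ∑ j ∈ Finset.range (r y), f (T^[j] (φ y))

variable [MeasurableSpace X] [MeasurableSpace Y]

/-- The measure on the tower with base `Y` and height function `r`, pushed to `X`: the floor of
level `j` sits over `{y | j < r y}` and is placed in `X` by `T^[j] ∘ φ`. -/
def towerMeasure (T : X → X) (φ : Y → X) (r : Y → ℕ) (d : Measure Y) : Measure X :=
  Measure.sum fun j : ℕ => (d.restrict {y | j < r y}).map (T^[j] ∘ φ)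

theorem towerMeasure_apply (hT : Measurable T) (hφ : Measurable φ)
    (d : Measure Y) {A : Set X} (hA : MeasurableSet A) :
    towerMeasure T φ r d A = ∑' j, d ({y | j < r y} ∩ (T^[j] ∘ φ) ⁻¹' A) := by
  rw [towerMeasure, Measure.sum_apply _ hA]
  refine tsum_congr fun j => ?_
  have hm : Measurable (T^[j] ∘ φ) := (hT.iterate j).comp hφ
  rw [Measure.map_apply hm hA, Measure.restrict_apply (hm hA), inter_comm]

theorem lintegral_towerMeasure (hT : Measurable T) (hφ : Measurable φ) (hr : Measurable r)
    (d : Measure Y) {f : X → ℝ≥0∞} (hf : Measurable f) :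
    ∫⁻ x, f x ∂(towerMeasure T φ r d) = ∫⁻ y, towerSum T φ r f y ∂d := by
  have hm (j : ℕ) : Measurable (T^[j] ∘ φ) := (hT.iterate j).comp hφ
  have hs (j : ℕ) : MeasurableSet {y | j < r y} := measurableSet_lt measurable_const hr
  rw [towerMeasure, lintegral_sum_measure]
  simp_rw [lintegral_map hf (hm _), ← lintegral_indicator (hs _)]
  rw [← lintegral_tsum fun j => by
    simpa only [Function.comp_def] using ((hf.comp (hm j)).indicator (hs j)).aemeasurable]
  refine lintegral_congr fun y => ?_
  rw [towerSum, tsum_eq_sum (s := Finset.range (r y))]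
  · refine Finset.sum_congr rfl fun j hj => ?_
    rw [indicator_of_mem (by simpa using hj)]
    rfl
  · intro j hj
    rw [indicator_of_notMem (by simpa using hj)]

/-- Sets in the base of the tower only meet the bottom floor. -/
theorem towerMeasure_apply_of_subset_range (hT : Measurable T) (hφ : Measurable φ)
    (hpos : ∀ y, 0 < r y) (hfirst : ∀ y j, 0 < j → j < r y → T^[j] (φ y) ∉ range φ)
    (d : Measure Y) {A : Set X} (hA : MeasurableSet A) (hAφ : A ⊆ range φ) :
    towerMeasure T φ r d A = d (φ ⁻¹' A) := by
  rw [towerMeasure_apply hT hφ d hA, tsum_eq_single 0]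
  · congr 1
    ext y
    simp [hpos y]
  · intro j hj
    convert measure_empty (μ := d)
    refine eq_empty_of_forall_notMem ?_
    rintro y ⟨hy, hyA⟩
    exact hfirst y j (Nat.pos_of_ne_zero hj) hy (hAφ hyA)

theorem towerMeasure_smul (c : ℝ≥0∞) (d : Measure Y) :
    towerMeasure T φ r (c • d) = c • towerMeasure T φ r d := by
  simp only [towerMeasure, Measure.restrict_smul, Measure.map_smul]
  ext A hA
  simp [Measure.sum_apply _ hA, ENNReal.tsum_mul_left]

/-- A tower measure fails to be invariant exactly as much as the measure on its base does: the
shift by `T` exchanges the bottom floor for the image of the return map. -/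
theorem towerMeasure_preimage (hT : Measurable T) (hφ : Measurable φ) (hr : Measurable r)
    (hret : ∀ y, φ (S y) = T^[r y] (φ y)) (hS : Measurable S)
    (d : Measure Y) {A : Set X} (hA : MeasurableSet A) :
    towerMeasure T φ r d (T ⁻¹' A) + d (φ ⁻¹' A) =
      towerMeasure T φ r d A + d (S ⁻¹' (φ ⁻¹' A)) := by
  have h1 (B : Set X) (hB : MeasurableSet B) : towerMeasure T φ r d B =
      ∫⁻ y, towerSum T φ r (B.indicator 1) y ∂d := by
    rw [← lintegral_indicator_one hB,
      lintegral_towerMeasure hT hφ hr d (measurable_one.indicator hB)]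
  have hA' : Measurable (A.indicator (1 : X → ℝ≥0∞)) := measurable_one.indicator hA
  rw [h1 _ (hT hA), h1 _ hA, ← lintegral_indicator_one (hφ hA),
    ← lintegral_indicator_one (hS (hφ hA)),
    ← lintegral_add_right _ (measurable_one.indicator (hφ hA)),
    ← lintegral_add_right _ (measurable_one.indicator (hS (hφ hA)))]
  refine lintegral_congr fun y => ?_
  have e1 : (φ ⁻¹' A).indicator (1 : Y → ℝ≥0∞) y = A.indicator 1 (T^[0] (φ y)) := rfl
  have e2 : (S ⁻¹' (φ ⁻¹' A)).indicator (1 : Y → ℝ≥0∞) y =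
      A.indicator 1 (T^[r y] (φ y)) := by
    rw [← hret]; rfl
  have e3 : towerSum T φ r ((T ⁻¹' A).indicator 1) y =
      ∑ j ∈ Finset.range (r y), A.indicator (1 : X → ℝ≥0∞) (T^[j + 1] (φ y)) := by
    refine Finset.sum_congr rfl fun j _ => ?_
    rw [Function.iterate_succ_apply']; rfl
  rw [e1, e2, e3, towerSum,
    ← Finset.sum_range_succ' (fun j => A.indicator (1 : X → ℝ≥0∞) (T^[j] (φ y))),
    ← Finset.sum_range_succ (fun j => A.indicator (1 : X → ℝ≥0∞) (T^[j] (φ y)))]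

/-- Kac's formula: an invariant measure is the tower measure over its restriction to a set that
every orbit meets within a bounded time, if `r` is the first return time to this set. -/
theorem eq_towerMeasure_comap (hT : Measurable T) (hφ : MeasurableEmbedding φ)
    (hret : ∀ y, φ (S y) = T^[r y] (φ y)) (hpos : ∀ y, 0 < r y)
    (hfirst : ∀ y j, 0 < j → j < r y → T^[j] (φ y) ∉ range φ)
    {N : ℕ} (hhit : ∀ x, ∃ j ≤ N, T^[j] x ∈ range φ)
    {μ : Measure X} (hμ : MeasurePreserving T μ μ) :
    μ = towerMeasure T φ r (μ.comap φ) := by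
  ext A hA
  have hJ : MeasurableSet (range φ) := hφ.measurableSet_range
  -- `E j` consists of the points of `T⁻ʲ A` whose first `j + 1` orbit points avoid the base.
  set E : ℕ → Set X := fun j => {x | (∀ i ≤ j, T^[i] x ∉ range φ) ∧ T^[j] x ∈ A} with hE
  have hE0 : E 0 = A \ range φ := by
    ext x; simp [hE, and_comm]
  have hEs (j : ℕ) : T ⁻¹' (E j) \ range φ = E (j + 1) := by
    ext x
    simp only [hE, Set.mem_sdiff, mem_preimage, mem_ofPred_eq, ← Function.iterate_succ_apply]
    constructor
    · rintro ⟨⟨h1, h2⟩, h3⟩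
      refine ⟨fun i hi => ?_, h2⟩
      rcases i with _ | i
      · exact h3
      · exact h1 i (by omega)
    · rintro ⟨h1, h2⟩
      exact ⟨⟨fun i hi => h1 (i + 1) (by omega), h2⟩, h1 0 (by omega)⟩
  have hEm (j : ℕ) : MeasurableSet (E j) := by
    induction j with
    | zero => rw [hE0]; exact hA.diff hJ
    | succ j ih => rw [← hEs]; exact (hT ih).diff hJ
  have hEN (j : ℕ) (hj : N ≤ j) : E j = ∅ := by
    refine eq_empty_of_forall_notMem fun x hx => ?_
    obtain ⟨i, hi, hx'⟩ := hhit x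
    exact hx.1 i (hi.trans hj) hx'
  have hfloor (j : ℕ) : (μ.comap φ) ({y | j + 1 < r y} ∩ (T^[j + 1] ∘ φ) ⁻¹' A) =
      μ (T ⁻¹' (E j) ∩ range φ) := by
    rw [hφ.comap_apply]
    congr 1
    ext x
    simp only [mem_image, mem_inter_iff, mem_preimage, mem_ofPred_eq, hE,
      ← Function.iterate_succ_apply, Function.comp_apply]
    constructor
    · rintro ⟨y, ⟨h1, h2⟩, rfl⟩
      exact ⟨⟨fun i hi => hfirst y _ (by omega) (by omega), h2⟩, mem_range_self y⟩
    · rintro ⟨⟨h1, h2⟩, ⟨y, rfl⟩⟩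
      refine ⟨y, ⟨?_, h2⟩, rfl⟩
      by_contra hlt
      have := hpos y
      apply h1 (r y - 1) (by omega)
      rw [Nat.succ_eq_add_one, Nat.sub_add_cancel this, ← hret]
      exact mem_range_self _
  have hrec (n : ℕ) : μ (E 0) =
      ∑ j ∈ Finset.range n, μ (T ⁻¹' (E j) ∩ range φ) + μ (E n) := by
    induction n with
    | zero => simp
    | succ n ih =>
      rw [ih, Finset.sum_range_succ, add_assoc, ← hEs n, measure_inter_add_sdiff _ hJ,
        hμ.measure_preimage (hEm n).nullMeasurableSet]
  rw [towerMeasure_apply hT hφ.measurable _ hA,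
    tsum_eq_zero_add' ENNReal.summable,
    tsum_congr hfloor, tsum_eq_sum (s := Finset.range N), ← measure_inter_add_sdiff A hJ,
    ← hE0, hrec N, hEN N le_rfl]
  · rw [measure_empty, add_zero, hφ.comap_apply]
    congr 2
    ext x
    simp only [mem_image, mem_inter_iff, mem_preimage, mem_ofPred_eq]
    constructor
    · rintro ⟨h1, ⟨y, rfl⟩⟩
      exact ⟨y, ⟨hpos y, h1⟩, rfl⟩
    · rintro ⟨y, ⟨-, h1⟩, rfl⟩
      exact ⟨h1, mem_range_self y⟩
  · intro j hj
    rw [hEN j (by simpa using hj)]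
    simp

/-- The restriction of an invariant measure to the base of a tower is invariant under the return
map. -/
theorem measurePreserving_comap (hT : Measurable T) (hφ : MeasurableEmbedding φ)
    (hr : Measurable r) (hS : Measurable S) (hret : ∀ y, φ (S y) = T^[r y] (φ y))
    {μ : Measure X} [IsFiniteMeasure μ] (hμ : MeasurePreserving T μ μ)
    (hkac : μ = towerMeasure T φ r (μ.comap φ)) :
    MeasurePreserving S (μ.comap φ) (μ.comap φ) := by
  refine ⟨hS, ?_⟩
  ext B hB
  rw [Measure.map_apply hS hB]
  have h := towerMeasure_preimage hT hφ.measurable hr hret hS (μ.comap φ)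
    (hφ.measurableSet_image.2 hB)
  rw [← hkac, hμ.measure_preimage (hφ.measurableSet_image.2 hB).nullMeasurableSet,
    preimage_image_eq _ hφ.injective] at h
  exact ((ENNReal.add_right_inj (measure_ne_top μ _)).1 h).symm

end Tower

/-! ### The return map to `[1 - α, 1)` -/

/-- The parameters reached from `paramRegion` by one application of `gauss`. The formula of the map
still defines a self-map of `[0,1)`; when `β ≤ 0` the third branch is empty, when `β = α` the
second one is. -/
def extRegion : Set (ℝ × ℝ) := {p | 0 < p.1 ∧ p.1 < 1 ∧ p.1 - 1 < p.2 ∧ p.2 ≤ p.1}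

theorem paramRegion_subset : paramRegion ⊆ extRegion := fun p hp => by
  obtain ⟨h1, h2, h3⟩ := hp
  exact ⟨by linarith, h3, by linarith, h2.le⟩

theorem mapFormula_mapsTo_of_mem_extRegion {p : ℝ × ℝ} (hp : p ∈ extRegion) :
    MapsTo (mapFormula p) (Ico 0 1) (Ico 0 1) := by
  obtain ⟨h1, h2, h3, h4⟩ := hp
  rintro x ⟨hx0, hx1⟩
  unfold mapFormula
  split_ifs <;> constructor <;> linarith

/-- The self-map of `[0,1)` with parameters in the larger region `extRegion`. -/
def extMap (p : ℝ × ℝ) (hp : p ∈ extRegion) : I → I :=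
  (mapFormula_mapsTo_of_mem_extRegion hp).restrict

theorem itm_eq_extMap {p : ℝ × ℝ} (hp : p ∈ paramRegion) :
    itm p hp = extMap p (paramRegion_subset hp) := rfl

theorem coe_extMap {p : ℝ × ℝ} (hp : p ∈ extRegion) (x : I) :
    (extMap p hp x : ℝ) = mapFormula p x := rfl

theorem measurable_mapFormula (p : ℝ × ℝ) : Measurable (mapFormula p) := by
  unfold mapFormula
  refine Measurable.ite measurableSet_Iio (by fun_prop) ?_
  exact Measurable.ite measurableSet_Iio (by fun_prop) (by fun_prop)

theorem measurable_extMap {p : ℝ × ℝ} (hp : p ∈ extRegion) : Measurable (extMap p hp) :=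
  ((measurable_mapFormula p).comp measurable_subtype_coe).subtype_mk

theorem measurableSet_branch₁ (p : ℝ × ℝ) : MeasurableSet (branch₁ p) :=
  measurable_subtype_coe measurableSet_Iio

theorem measurableSet_branch₂ (p : ℝ × ℝ) : MeasurableSet (branch₂ p) :=
  measurable_subtype_coe (measurableSet_Ico (a := 1 - p.1) (b := 1 - p.2))

theorem measurableSet_branch₃ (p : ℝ × ℝ) : MeasurableSet (branch₃ p) :=
  measurable_subtype_coe measurableSet_Ici

variable {p : ℝ × ℝ}

theorem one_le_floor (hp : p ∈ paramRegion) : 1 ≤ ⌊1 / p.1⌋₊ := by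
  obtain ⟨h1, h2, h3⟩ := hp
  rw [Nat.one_le_floor_iff, le_div_iff₀ (by linarith)]
  linarith

theorem floor_mul_le (hp : p ∈ paramRegion) : (⌊1 / p.1⌋₊ : ℝ) * p.1 ≤ 1 := by
  obtain ⟨h1, h2, h3⟩ := hp
  have h : (0 : ℝ) < p.1 := by linarith
  rw [← le_div_iff₀ h]
  exact Nat.floor_le (by positivity)

theorem lt_floor_add_one_mul (hp : p ∈ paramRegion) : 1 < ((⌊1 / p.1⌋₊ : ℝ) + 1) * p.1 := by
  obtain ⟨h1, h2, h3⟩ := hp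
  have h : (0 : ℝ) < p.1 := by linarith
  rw [← div_lt_iff₀ h]
  exact Nat.lt_floor_add_one _

theorem mul_gauss_fst (hp : p ∈ paramRegion) : p.1 * (gauss p).1 = p.2 := by
  have h : p.1 ≠ 0 := by linarith [hp.1, hp.2.1]
  simp only [gauss]
  field_simp

theorem mul_gauss_snd (hp : p ∈ paramRegion) :
    p.1 * (gauss p).2 = p.2 - 1 + ⌊1 / p.1⌋₊ * p.1 := by
  have h : p.1 ≠ 0 := by linarith [hp.1, hp.2.1]
  simp only [gauss]
  field_simp

theorem gauss_mem_extRegion (hp : p ∈ paramRegion) : gauss p ∈ extRegion := by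
  have h : 0 < p.1 := by linarith [hp.1, hp.2.1]
  have h1 := mul_gauss_fst hp
  have h2 := mul_gauss_snd hp
  have h3 := floor_mul_le hp
  have h4 := lt_floor_add_one_mul hp
  obtain ⟨h5, h6, h7⟩ := hp
  refine ⟨lt_of_mul_lt_mul_left ?_ h.le, lt_of_mul_lt_mul_left ?_ h.le,
    lt_of_mul_lt_mul_left ?_ h.le, le_of_mul_le_mul_left ?_ h⟩ <;> linarith

/-- The affine bijection of `[0,1)` onto the interval `[1 - α, 1)`. -/
def returnEmb (p : ℝ × ℝ) (hp : p ∈ paramRegion) (u : I) : I :=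
  ⟨1 - p.1 + p.1 * u, by
    obtain ⟨h1, h2, h3⟩ := hp
    have h := u.2.1
    have h' := u.2.2
    constructor <;> nlinarith⟩

theorem coe_returnEmb (hp : p ∈ paramRegion) (u : I) :
    (returnEmb p hp u : ℝ) = 1 - p.1 + p.1 * u := rfl

theorem range_returnEmb (hp : p ∈ paramRegion) : range (returnEmb p hp) = (branch₁ p)ᶜ := by
  have h : 0 < p.1 := by linarith [hp.1, hp.2.1]
  ext x
  simp only [mem_range, mem_compl_iff, branch₁, mem_ofPred_eq, not_lt]
  constructor
  · rintro ⟨u, rfl⟩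
    rw [coe_returnEmb]
    have := mul_nonneg h.le u.2.1
    linarith
  · intro hx
    refine ⟨⟨(x - (1 - p.1)) / p.1, by apply div_nonneg <;> linarith, ?_⟩, ?_⟩
    · rw [div_lt_one h]
      linarith [x.2.2]
    · apply Subtype.ext
      rw [coe_returnEmb]
      field_simp
      ring

theorem measurableEmbedding_returnEmb (hp : p ∈ paramRegion) :
    MeasurableEmbedding (returnEmb p hp) := by
  have h : 0 < p.1 := by linarith [hp.1, hp.2.1]
  have : StandardBorelSpace I := measurableSet_Ico.standardBorel
  refine Measurable.measurableEmbedding ?_ ?_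
  · exact Measurable.subtype_mk (by fun_prop)
  · intro u v huv
    have : 1 - p.1 + p.1 * (u : ℝ) = 1 - p.1 + p.1 * v := congrArg Subtype.val huv
    apply Subtype.ext
    exact mul_left_cancel₀ h.ne' (by linarith)

/-- The first return time to `[1 - α, 1)`, in the rescaled coordinate `u ∈ [0,1)`. -/
def returnTime (p : ℝ × ℝ) (u : I) : ℕ :=
  if (u : ℝ) < 1 - (gauss p).1 then 1
  else if (u : ℝ) < 1 - (gauss p).2 then ⌊1 / p.1⌋₊ + 1
  else ⌊1 / p.1⌋₊

theorem measurable_returnTime (p : ℝ × ℝ) : Measurable (returnTime p) := by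
  unfold returnTime
  refine Measurable.ite (measurableSet_branch₁ _) measurable_const ?_
  exact Measurable.ite (measurable_subtype_coe measurableSet_Iio) measurable_const
    measurable_const

theorem returnTime_pos (hp : p ∈ paramRegion) (u : I) : 0 < returnTime p u := by
  have := one_le_floor hp
  unfold returnTime
  split_ifs <;> omega

theorem returnTime_le (hp : p ∈ paramRegion) (u : I) : returnTime p u ≤ ⌊1 / p.1⌋₊ + 1 := by
  have := one_le_floor hp
  unfold returnTime
  split_ifs <;> omega

theorem extMap_returnEmb (hp : p ∈ paramRegion) {u : I} (hu : (u : ℝ) < 1 - (gauss p).1) :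
    (extMap p (paramRegion_subset hp) (returnEmb p hp u) : ℝ) = 1 - p.1 + p.1 * u + p.2 := by
  have h : 0 < p.1 := by linarith [hp.1, hp.2.1]
  have h1 := mul_gauss_fst hp
  have h2 := mul_lt_mul_of_pos_left hu h
  have h3 := mul_nonneg h.le u.2.1
  rw [coe_extMap, coe_returnEmb, mapFormula, if_neg (by linarith), if_pos (by linarith)]

/-- A point of the third branch is sent to `[0, β)`, from where it advances by steps `α`. -/
theorem iterate_extMap_returnEmb (hp : p ∈ paramRegion) {u : I} (hu : 1 - (gauss p).1 ≤ (u : ℝ))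
    {j : ℕ} (hj : j < ⌊1 / p.1⌋₊) :
    ((extMap p (paramRegion_subset hp))^[j + 1] (returnEmb p hp u) : ℝ) =
      p.1 * u + p.2 - p.1 + j * p.1 := by
  have h : 0 < p.1 := by linarith [hp.1, hp.2.1]
  have h1 := mul_gauss_fst hp
  have h2 := mul_le_mul_of_nonneg_left hu h.le
  have h3 := mul_lt_mul_of_pos_left u.2.2 h
  induction j with
  | zero =>
    have := hp.2.1
    rw [zero_add, Function.iterate_one, coe_extMap, coe_returnEmb, mapFormula,
      if_neg (by linarith), if_neg (by linarith)]
    push_cast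
    ring
  | succ j ih =>
    have h4 : ((j : ℝ) + 1 + 1) * p.1 ≤ ⌊1 / p.1⌋₊ * p.1 := by
      refine mul_le_mul_of_nonneg_right ?_ h.le
      exact_mod_cast hj
    have h5 := floor_mul_le hp
    have := hp.2.1
    rw [Function.iterate_succ_apply', coe_extMap, ih (by omega), mapFormula,
      if_pos (by linarith)]
    push_cast
    ring

theorem iterate_extMap_returnEmb_lt (hp : p ∈ paramRegion) {u : I}
    (hu : 1 - (gauss p).1 ≤ (u : ℝ)) {j : ℕ} (hj : j + 1 < ⌊1 / p.1⌋₊) :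
    ((extMap p (paramRegion_subset hp))^[j + 1] (returnEmb p hp u) : ℝ) < 1 - p.1 := by
  have h : 0 < p.1 := by linarith [hp.1, hp.2.1]
  have h3 := mul_lt_mul_of_pos_left u.2.2 h
  have h4 : ((j : ℝ) + 1 + 1) * p.1 ≤ ⌊1 / p.1⌋₊ * p.1 := by
    refine mul_le_mul_of_nonneg_right ?_ h.le
    exact_mod_cast hj
  have h5 := floor_mul_le hp
  have := hp.2.1
  rw [iterate_extMap_returnEmb hp hu (by omega)]
  linarith

/-- The `⌊1/α⌋`-th iterate lies in the first branch exactly over the second branch of the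
renormalized map. -/
theorem iterate_floor_extMap_returnEmb (hp : p ∈ paramRegion) {u : I}
    (hu : 1 - (gauss p).1 ≤ (u : ℝ)) :
    ((extMap p (paramRegion_subset hp))^[⌊1 / p.1⌋₊] (returnEmb p hp u) : ℝ) =
      1 - p.1 + p.1 * (u + (gauss p).2 - 1) := by
  have h6 := one_le_floor hp
  obtain ⟨m, hm⟩ : ∃ m, ⌊1 / p.1⌋₊ = m + 1 := ⟨⌊1 / p.1⌋₊ - 1, by omega⟩
  have h2 := mul_gauss_snd hp
  have h := iterate_extMap_returnEmb hp hu (j := m) (by omega)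
  rw [hm] at h2 ⊢
  rw [h]
  push_cast at h2
  linarith

theorem iterate_floor_extMap_returnEmb_lt_iff (hp : p ∈ paramRegion) {u : I}
    (hu : 1 - (gauss p).1 ≤ (u : ℝ)) :
    ((extMap p (paramRegion_subset hp))^[⌊1 / p.1⌋₊] (returnEmb p hp u) : ℝ) < 1 - p.1 ↔
      (u : ℝ) < 1 - (gauss p).2 := by
  have h : 0 < p.1 := by linarith [hp.1, hp.2.1]
  rw [iterate_floor_extMap_returnEmb hp hu]
  constructor
  · intro hlt
    have : p.1 * (u + (gauss p).2 - 1) < p.1 * 0 := by linarith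
    have := lt_of_mul_lt_mul_left this h.le
    linarith
  · intro hlt
    have := mul_pos h (by linarith : 0 < 1 - (gauss p).2 - u)
    linarith

/-- The return map to `[1 - α, 1)` is, after rescaling, the map with parameters `gauss p`. -/
theorem returnEmb_extMap_gauss (hp : p ∈ paramRegion) (u : I) :
    returnEmb p hp (extMap (gauss p) (gauss_mem_extRegion hp) u) =
      (extMap p (paramRegion_subset hp))^[returnTime p u] (returnEmb p hp u) := by
  have h1 := mul_gauss_fst hp
  apply Subtype.ext
  rw [coe_returnEmb, coe_extMap, mapFormula, returnTime]
  split_ifs with hu hu'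
  · rw [Function.iterate_one, extMap_returnEmb hp hu]
    linarith
  · have hlt := (iterate_floor_extMap_returnEmb_lt_iff hp (not_lt.1 hu)).2 hu'
    rw [Function.iterate_succ_apply', coe_extMap, mapFormula, if_pos hlt,
      iterate_floor_extMap_returnEmb hp (not_lt.1 hu)]
    ring
  · rw [iterate_floor_extMap_returnEmb hp (not_lt.1 hu)]

theorem iterate_notMem_range_returnEmb (hp : p ∈ paramRegion) (u : I) (j : ℕ) (hj : 0 < j)
    (hlt : j < returnTime p u) :
    (extMap p (paramRegion_subset hp))^[j] (returnEmb p hp u) ∉ range (returnEmb p hp) := by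
  rw [range_returnEmb, notMem_compl_iff, branch₁, mem_ofPred_eq]
  obtain ⟨i, rfl⟩ : ∃ i, j = i + 1 := ⟨j - 1, by omega⟩
  unfold returnTime at hlt
  split_ifs at hlt with hu hu'
  · omega
  · rcases (Nat.lt_succ_iff.1 hlt).lt_or_eq with h | h
    · exact iterate_extMap_returnEmb_lt hp (not_lt.1 hu) h
    · rw [h]
      exact (iterate_floor_extMap_returnEmb_lt_iff hp (not_lt.1 hu)).2 hu'
  · exact iterate_extMap_returnEmb_lt hp (not_lt.1 hu) hlt

theorem exists_iterate_mem_range_returnEmb (hp : p ∈ paramRegion) (x : I) :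
    ∃ j ≤ ⌊1 / p.1⌋₊, (extMap p (paramRegion_subset hp))^[j] x ∈ range (returnEmb p hp) := by
  by_contra! hcon
  have hlt (j : ℕ) (hj : j ≤ ⌊1 / p.1⌋₊) :
      ((extMap p (paramRegion_subset hp))^[j] x : ℝ) < 1 - p.1 := by
    have := hcon j hj
    rwa [range_returnEmb, notMem_compl_iff] at this
  have hval (j : ℕ) (hj : j ≤ ⌊1 / p.1⌋₊) :
      ((extMap p (paramRegion_subset hp))^[j] x : ℝ) = x + j * p.1 := by
    induction j with
    | zero => simp
    | succ j ih =>
      rw [Function.iterate_succ_apply', coe_extMap, mapFormula, if_pos (hlt j (by omega)),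
        ih (by omega)]
      push_cast
      ring
  have h1 := hlt _ le_rfl
  rw [hval _ le_rfl] at h1
  have h2 := lt_floor_add_one_mul hp
  linarith [x.2.1]

/-- Iterates of the renormalized map are iterates of the map. -/
theorem exists_iterate_returnEmb (hp : p ∈ paramRegion) (u : I) (j : ℕ) :
    ∃ t, j ≤ t ∧ t ≤ j * (⌊1 / p.1⌋₊ + 1) ∧
      returnEmb p hp ((extMap (gauss p) (gauss_mem_extRegion hp))^[j] u) =
        (extMap p (paramRegion_subset hp))^[t] (returnEmb p hp u) := by
  induction j with
  | zero => exact ⟨0, by simp⟩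
  | succ j ih =>
    obtain ⟨t, h1, h2, h3⟩ := ih
    set v := (extMap (gauss p) (gauss_mem_extRegion hp))^[j] u with hv
    have h4 := returnTime_pos hp v
    have h5 := returnTime_le hp v
    refine ⟨returnTime p v + t, by omega, by rw [add_mul, one_mul]; omega, ?_⟩
    rw [Function.iterate_succ_apply', returnEmb_extMap_gauss, ← hv, h3,
      Function.iterate_add_apply]

/-- The tower over the renormalized map. -/
def lift (p : ℝ × ℝ) (hp : p ∈ paramRegion) (d : Measure I) : Measure I :=
  towerMeasure (extMap p (paramRegion_subset hp)) (returnEmb p hp) (returnTime p) d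

/-- Kac's formula for the interval translation map. -/
theorem eq_lift_comap (hp : p ∈ paramRegion) {μ : Measure I}
    (hμ : MeasurePreserving (extMap p (paramRegion_subset hp)) μ μ) :
    μ = lift p hp (μ.comap (returnEmb p hp)) :=
  eq_towerMeasure_comap (measurable_extMap _) (measurableEmbedding_returnEmb hp)
    (returnEmb_extMap_gauss hp) (returnTime_pos hp)
    (iterate_notMem_range_returnEmb hp) (exists_iterate_mem_range_returnEmb hp) hμ

theorem measurePreserving_comap_returnEmb (hp : p ∈ paramRegion) {μ : Measure I}
    [IsFiniteMeasure μ] (hμ : MeasurePreserving (extMap p (paramRegion_subset hp)) μ μ) :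
    MeasurePreserving (extMap (gauss p) (gauss_mem_extRegion hp))
      (μ.comap (returnEmb p hp)) (μ.comap (returnEmb p hp)) :=
  measurePreserving_comap (measurable_extMap _) (measurableEmbedding_returnEmb hp)
    (measurable_returnTime p) (measurable_extMap _) (returnEmb_extMap_gauss hp) hμ
    (eq_lift_comap hp hμ)

/-! ### Letters of the branches and their frequencies -/

/-- The index of the branch containing a point. -/
def letter (p : ℝ × ℝ) (x : I) : ℕ :=
  if (x : ℝ) < 1 - p.1 then 1 else if (x : ℝ) < 1 - p.2 then 2 else 3

theorem letter_mem (p : ℝ × ℝ) (x : I) : letter p x = 1 ∨ letter p x = 2 ∨ letter p x = 3 := by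
  unfold letter
  split_ifs <;> simp

theorem mem_branch₁_iff {x : I} : x ∈ branch₁ p ↔ letter p x = 1 := by
  unfold letter branch₁
  split_ifs <;> simp_all

theorem mem_branch₂_iff {x : I} : x ∈ branch₂ p ↔ letter p x = 2 := by
  unfold letter branch₂
  grind

theorem mem_branch₃_iff (hp : p ∈ extRegion) {x : I} : x ∈ branch₃ p ↔ letter p x = 3 := by
  have := hp.2.2.2
  unfold letter branch₃
  split_ifs <;> simp <;> linarith

theorem lintegral_comp_letter (hp : p ∈ extRegion) (c : ℕ → ℝ≥0∞) (μ : Measure I) :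
    ∫⁻ x, c (letter p x) ∂μ =
      c 1 * μ (branch₁ p) + c 2 * μ (branch₂ p) + c 3 * μ (branch₃ p) := by
  have h1 := measurableSet_branch₁ p
  have h2 := measurableSet_branch₂ p
  have h3 := measurableSet_branch₃ p
  rw [← lintegral_indicator_const h1, ← lintegral_indicator_const h2,
    ← lintegral_indicator_const h3,
    ← lintegral_add_right _ (measurable_const.indicator h2),
    ← lintegral_add_right _ (measurable_const.indicator h3)]
  refine lintegral_congr fun x => ?_
  simp only [indicator, mem_branch₁_iff, mem_branch₂_iff, mem_branch₃_iff hp]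
  rcases letter_mem p x with h | h | h <;> simp [h]

theorem measure_univ_eq_add_branch (hp : p ∈ extRegion) (μ : Measure I) :
    μ univ = μ (branch₁ p) + μ (branch₂ p) + μ (branch₃ p) := by
  simpa using lintegral_comp_letter hp (fun _ => 1) μ

theorem measureReal_univ_eq_add_branch (hp : p ∈ extRegion) (μ : Measure I) [IsFiniteMeasure μ] :
    μ.real univ = μ.real (branch₁ p) + μ.real (branch₂ p) + μ.real (branch₃ p) := by
  simp only [Measure.real]
  rw [measure_univ_eq_add_branch hp μ, ENNReal.toReal_add, ENNReal.toReal_add] <;> simp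

/-- Letters along the tower: the substitution `1 → 2`, `2 → 3 1ᵏ`, `3 → 3 1ᵏ⁻¹`. -/
theorem letter_iterate (hp : p ∈ paramRegion) (u : I) {j : ℕ} (hj : j < returnTime p u) :
    letter p ((extMap p (paramRegion_subset hp))^[j] (returnEmb p hp u)) =
      if j = 0 then (if letter (gauss p) u = 1 then 2 else 3) else 1 := by
  split_ifs with h0 hu
  · rw [← mem_branch₁_iff, branch₁, mem_ofPred_eq] at hu
    subst h0
    rw [Function.iterate_zero_apply, ← mem_branch₂_iff]
    have h : 0 < p.1 := by linarith [hp.1, hp.2.1]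
    have h1 := mul_gauss_fst hp
    have h2 := mul_lt_mul_of_pos_left hu h
    have h3 := mul_nonneg h.le u.2.1
    constructor <;> rw [coe_returnEmb] <;> linarith
  · rw [← mem_branch₁_iff, branch₁, mem_ofPred_eq, not_lt] at hu
    subst h0
    rw [Function.iterate_zero_apply, ← mem_branch₃_iff (paramRegion_subset hp), branch₃,
      mem_ofPred_eq, coe_returnEmb]
    have h : 0 < p.1 := by linarith [hp.1, hp.2.1]
    have h1 := mul_gauss_fst hp
    have h2 := mul_le_mul_of_nonneg_left hu h.le
    linarith
  · have := iterate_notMem_range_returnEmb hp u j (by omega) hj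
    rwa [range_returnEmb, notMem_compl_iff, mem_branch₁_iff] at this

theorem returnTime_eq_letter (p : ℝ × ℝ) (u : I) :
    returnTime p u = if letter (gauss p) u = 1 then 1
      else if letter (gauss p) u = 2 then ⌊1 / p.1⌋₊ + 1 else ⌊1 / p.1⌋₊ := by
  unfold returnTime letter
  split_ifs <;> simp_all

/-- The transpose of the abelianized substitution, acting on functions of one letter. -/
def letterSum (p : ℝ × ℝ) (c : ℕ → ℝ≥0∞) (i : ℕ) : ℝ≥0∞ :=
  if i = 1 then c 2
  else if i = 2 then c 3 + ⌊1 / p.1⌋₊ * c 1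
  else c 3 + ((⌊1 / p.1⌋₊ - 1 : ℕ) : ℝ≥0∞) * c 1

theorem towerSum_comp_letter (hp : p ∈ paramRegion) (c : ℕ → ℝ≥0∞) (u : I) :
    towerSum (extMap p (paramRegion_subset hp)) (returnEmb p hp) (returnTime p)
      (fun x => c (letter p x)) u = letterSum p c (letter (gauss p) u) := by
  obtain ⟨m, hm⟩ : ∃ m, returnTime p u = m + 1 :=
    ⟨returnTime p u - 1, by have := returnTime_pos hp u; omega⟩
  have h1 : towerSum (extMap p (paramRegion_subset hp)) (returnEmb p hp) (returnTime p)
      (fun x => c (letter p x)) u =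
      m * c 1 + c (if letter (gauss p) u = 1 then 2 else 3) := by
    rw [towerSum, hm, Finset.sum_range_succ', letter_iterate hp u (by omega), if_pos rfl]
    congr 1
    rw [Finset.sum_congr rfl (g := fun _ => c 1), Finset.sum_const, Finset.card_range,
      nsmul_eq_mul]
    intro j hj
    rw [letter_iterate hp u (by rw [hm]; simpa using hj), if_neg (by omega)]
  have hk := one_le_floor hp
  rw [h1, letterSum]
  rw [returnTime_eq_letter] at hm
  split_ifs at hm ⊢
  · obtain rfl : m = 0 := by omega
    simp
  · obtain rfl : m = ⌊1 / p.1⌋₊ := by omega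
    rw [add_comm]
  · obtain rfl : m = ⌊1 / p.1⌋₊ - 1 := by omega
    rw [add_comm]

theorem lintegral_lift (hp : p ∈ paramRegion) (d : Measure I) {f : I → ℝ≥0∞}
    (hf : Measurable f) :
    ∫⁻ x, f x ∂(lift p hp d) = ∫⁻ u, towerSum (extMap p (paramRegion_subset hp))
      (returnEmb p hp) (returnTime p) f u ∂d :=
  lintegral_towerMeasure (measurable_extMap _) (measurableEmbedding_returnEmb hp).measurable
    (measurable_returnTime p) d hf

theorem measurable_letter (p : ℝ × ℝ) : Measurable (letter p) := by
  unfold letter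
  refine Measurable.ite (measurableSet_branch₁ _) measurable_const ?_
  exact Measurable.ite (measurable_subtype_coe measurableSet_Iio) measurable_const
    measurable_const

theorem lintegral_lift_comp_letter (hp : p ∈ paramRegion) (d : Measure I) (c : ℕ → ℝ≥0∞) :
    ∫⁻ x, c (letter p x) ∂(lift p hp d) = ∫⁻ u, letterSum p c (letter (gauss p) u) ∂d := by
  rw [lintegral_lift hp d (f := fun x => c (letter p x))
    ((measurable_from_nat (f := c)).comp (measurable_letter p))]
  simp_rw [towerSum_comp_letter hp]

theorem lift_branch₁ (hp : p ∈ paramRegion) (d : Measure I) :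
    lift p hp d (branch₁ p) = ⌊1 / p.1⌋₊ * d (branch₂ (gauss p)) +
      ((⌊1 / p.1⌋₊ - 1 : ℕ) : ℝ≥0∞) * d (branch₃ (gauss p)) := by
  have h := lintegral_lift_comp_letter hp d (fun i => if i = 1 then 1 else 0)
  rw [lintegral_comp_letter (paramRegion_subset hp) (fun i => if i = 1 then 1 else 0),
    lintegral_comp_letter (gauss_mem_extRegion hp)] at h
  simpa [letterSum] using h

theorem lift_branch₂ (hp : p ∈ paramRegion) (d : Measure I) :
    lift p hp d (branch₂ p) = d (branch₁ (gauss p)) := by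
  have h := lintegral_lift_comp_letter hp d (fun i => if i = 2 then 1 else 0)
  rw [lintegral_comp_letter (paramRegion_subset hp) (fun i => if i = 2 then 1 else 0),
    lintegral_comp_letter (gauss_mem_extRegion hp)] at h
  simpa [letterSum] using h

theorem lift_branch₃ (hp : p ∈ paramRegion) (d : Measure I) :
    lift p hp d (branch₃ p) = d (branch₂ (gauss p)) + d (branch₃ (gauss p)) := by
  have h := lintegral_lift_comp_letter hp d (fun i => if i = 3 then 1 else 0)
  rw [lintegral_comp_letter (paramRegion_subset hp) (fun i => if i = 3 then 1 else 0),
    lintegral_comp_letter (gauss_mem_extRegion hp)] at h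
  simpa [letterSum] using h

theorem isFiniteMeasure_lift (hp : p ∈ paramRegion) (d : Measure I) [IsFiniteMeasure d] :
    IsFiniteMeasure (lift p hp d) := by
  refine ⟨?_⟩
  rw [measure_univ_eq_add_branch (paramRegion_subset hp), lift_branch₁, lift_branch₂,
    lift_branch₃]
  simp only [ENNReal.add_lt_top]
  refine ⟨⟨⟨?_, ?_⟩, measure_lt_top _ _⟩, measure_lt_top _ _, measure_lt_top _ _⟩ <;>
  exact ENNReal.mul_lt_top (ENNReal.natCast_lt_top _) (measure_lt_top _ _)

theorem lift_real_branch₁ (hp : p ∈ paramRegion) (d : Measure I) [IsFiniteMeasure d] :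
    (lift p hp d).real (branch₁ p) = ⌊1 / p.1⌋₊ * d.real (branch₂ (gauss p)) +
      ((⌊1 / p.1⌋₊ : ℝ) - 1) * d.real (branch₃ (gauss p)) := by
  have := one_le_floor hp
  rw [Measure.real, lift_branch₁, ENNReal.toReal_add, ENNReal.toReal_mul, ENNReal.toReal_mul,
    ENNReal.toReal_natCast, ENNReal.toReal_natCast, Nat.cast_sub this, Nat.cast_one]
  · rfl
  all_goals simp [ENNReal.mul_eq_top]

theorem lift_real_branch₂ (hp : p ∈ paramRegion) (d : Measure I) :
    (lift p hp d).real (branch₂ p) = d.real (branch₁ (gauss p)) := by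
  rw [Measure.real, lift_branch₂]
  rfl

theorem lift_real_branch₃ (hp : p ∈ paramRegion) (d : Measure I) [IsFiniteMeasure d] :
    (lift p hp d).real (branch₃ p) =
      d.real (branch₂ (gauss p)) + d.real (branch₃ (gauss p)) := by
  rw [Measure.real, lift_branch₃, ENNReal.toReal_add] <;> simp [Measure.real]

/-! ### An invariant measure is determined by its letter frequencies -/

/-- All renormalizations of the map stay in the parameter triangle. -/
def IsRenormalizable (p : ℝ × ℝ) : Prop := ∀ n, gauss^[n] p ∈ paramRegion

theorem IsRenormalizable.mem (h : IsRenormalizable p) : p ∈ paramRegion := h 0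

theorem IsRenormalizable.renorm (h : IsRenormalizable p) : IsRenormalizable (gauss p) := fun n => by
  rw [← Function.iterate_succ_apply]
  exact h (n + 1)

theorem extMap_sub_extMap (hp : p ∈ extRegion) {x y : I} (h : letter p x = letter p y) :
    (extMap p hp x : ℝ) - extMap p hp y = x - y := by
  rw [coe_extMap, coe_extMap, mapFormula, mapFormula]
  unfold letter at h
  split_ifs at h ⊢ <;> first | omega | ring

theorem iterate_sub_iterate (hp : p ∈ paramRegion) {u v : I}
    (h : letter (gauss p) u = letter (gauss p) v) {j : ℕ} (hj : j < returnTime p u) :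
    ((extMap p (paramRegion_subset hp))^[j] (returnEmb p hp u) : ℝ) -
      (extMap p (paramRegion_subset hp))^[j] (returnEmb p hp v) = p.1 * (u - v) := by
  have hr : returnTime p u = returnTime p v := by
    rw [returnTime_eq_letter, returnTime_eq_letter, h]
  induction j with
  | zero =>
    rw [Function.iterate_zero_apply, Function.iterate_zero_apply, coe_returnEmb, coe_returnEmb]
    ring
  | succ j ih =>
    rw [Function.iterate_succ_apply', Function.iterate_succ_apply', extMap_sub_extMap,
      ih (by omega)]
    rw [letter_iterate hp u (by omega), letter_iterate hp v (by omega), h]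

/-- On each branch, `g` varies by at most `c · Λ · |u - v|`, where `c` is the value attached to
the letter of the branch. Passing to tower sums keeps this form and replaces `Λ` by `α Λ`. -/
def SlowlyVarying (p : ℝ × ℝ) (g : I → ℝ≥0∞) (c : ℕ → ℝ≥0∞) (Λ : ℝ) : Prop :=
  ∀ u v, letter p u = letter p v → g u ≤ g v + c (letter p u) * ENNReal.ofReal (Λ * |(u : ℝ) - v|)

theorem SlowlyVarying.towerSum (hp : p ∈ paramRegion) {g : I → ℝ≥0∞} {c : ℕ → ℝ≥0∞} {Λ : ℝ}
    (h : SlowlyVarying p g c Λ) :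
    SlowlyVarying (gauss p) (towerSum (extMap p (paramRegion_subset hp)) (returnEmb p hp)
      (returnTime p) g) (letterSum p c) (Λ * p.1) := by
  intro u v huv
  have hr : returnTime p u = returnTime p v := by
    rw [returnTime_eq_letter, returnTime_eq_letter, huv]
  rw [← towerSum_comp_letter hp, TranslationMap.towerSum, TranslationMap.towerSum,
    TranslationMap.towerSum, ← hr, Finset.sum_mul, ← Finset.sum_add_distrib]
  refine Finset.sum_le_sum fun j hj => ?_
  have hj' := Finset.mem_range.1 hj
  have h1 := h ((extMap p (paramRegion_subset hp))^[j] (returnEmb p hp u))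
    ((extMap p (paramRegion_subset hp))^[j] (returnEmb p hp v))
    (by rw [letter_iterate hp u hj', letter_iterate hp v (hr ▸ hj'), huv])
  have hpos : 0 < p.1 := by linarith [hp.1, hp.2.1]
  rwa [iterate_sub_iterate hp huv hj', abs_mul, abs_of_pos hpos, ← mul_assoc] at h1

/-- Two measures giving the same mass to a set give almost the same integral over it to a function
that is almost constant there. -/
theorem setLIntegral_le_of_measure_eq {X : Type*} [MeasurableSpace X] {μ ν : Measure X}
    [IsFiniteMeasure μ] {B : Set X} (hB : MeasurableSet B) (h : μ B = ν B) {g : X → ℝ≥0∞}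
    {e : ℝ≥0∞} (hg : ∀ u ∈ B, ∀ v ∈ B, g u ≤ g v + e) :
    ∫⁻ x in B, g x ∂μ ≤ ∫⁻ x in B, g x ∂ν + e * μ B := by
  have h1 : ⨆ u ∈ B, g u ≤ (⨅ v ∈ B, g v) + e := by
    refine iSup₂_le fun u hu => ?_
    rw [ENNReal.iInf_add]
    refine le_iInf fun v => ?_
    rw [ENNReal.iInf_add]
    exact le_iInf fun hv => hg u hu v hv
  calc ∫⁻ x in B, g x ∂μ ≤ ∫⁻ _ in B, (⨆ u ∈ B, g u) ∂μ :=
        setLIntegral_mono' hB fun x hx => le_iSup₂ (f := fun u (_ : u ∈ B) => g u) x hx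
    _ = (⨆ u ∈ B, g u) * μ B := by simp
    _ ≤ ((⨅ v ∈ B, g v) + e) * μ B := by gcongr
    _ = (∫⁻ _ in B, (⨅ v ∈ B, g v) ∂ν) + e * μ B := by rw [add_mul]; simp [h]
    _ ≤ ∫⁻ x in B, g x ∂ν + e * μ B := by
        refine add_le_add_left ?_ _
        refine setLIntegral_mono' hB fun x hx => ?_
        exact iInf₂_le (f := fun u (_ : u ∈ B) => g u) x hx

theorem setLIntegral_branches (hp : p ∈ extRegion) (g : I → ℝ≥0∞) (μ : Measure I) :
    ∫⁻ x, g x ∂μ = ∫⁻ x in branch₁ p, g x ∂μ + ∫⁻ x in branch₂ p, g x ∂μ +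
      ∫⁻ x in branch₃ p, g x ∂μ := by
  rw [← lintegral_union (measurableSet_branch₂ p), ← lintegral_union (measurableSet_branch₃ p),
    ← setLIntegral_univ]
  · congr 2
    ext x
    simp only [mem_univ, mem_union, mem_branch₁_iff, mem_branch₂_iff, mem_branch₃_iff hp,
      true_iff]
    have := letter_mem p x
    tauto
  · rw [Set.disjoint_left]
    intro x
    simp only [mem_union, mem_branch₁_iff, mem_branch₂_iff, mem_branch₃_iff hp]
    omega
  · rw [Set.disjoint_left]
    intro x
    simp only [mem_branch₁_iff, mem_branch₂_iff]
    omega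

theorem SlowlyVarying.lintegral_le_of_branch_eq (hp : p ∈ extRegion) {g : I → ℝ≥0∞}
    {c : ℕ → ℝ≥0∞} {Λ : ℝ} (hΛ : 0 ≤ Λ) (h : SlowlyVarying p g c Λ)
    {μ ν : Measure I} [IsFiniteMeasure μ]
    (h1 : μ (branch₁ p) = ν (branch₁ p)) (h2 : μ (branch₂ p) = ν (branch₂ p))
    (h3 : μ (branch₃ p) = ν (branch₃ p)) :
    ∫⁻ x, g x ∂μ ≤ ∫⁻ x, g x ∂ν + ENNReal.ofReal Λ * ∫⁻ x, c (letter p x) ∂μ := by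
  have key (u v : I) (i : ℕ) (hu : letter p u = i) (hv : letter p v = i) :
      g u ≤ g v + c i * ENNReal.ofReal Λ := by
    have h0 := h u v (hu.trans hv.symm)
    rw [hu] at h0
    refine h0.trans ?_
    gcongr
    have : |(u : ℝ) - v| ≤ 1 := by
      rw [abs_le]
      constructor <;> linarith [u.2.1, u.2.2, v.2.1, v.2.2]
    exact mul_le_of_le_one_right hΛ this
  have e1 := setLIntegral_le_of_measure_eq (measurableSet_branch₁ p) h1 (g := g)
    fun u hu v hv => key u v 1 (mem_branch₁_iff.1 hu) (mem_branch₁_iff.1 hv)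
  have e2 := setLIntegral_le_of_measure_eq (measurableSet_branch₂ p) h2 (g := g)
    fun u hu v hv => key u v 2 (mem_branch₂_iff.1 hu) (mem_branch₂_iff.1 hv)
  have e3 := setLIntegral_le_of_measure_eq (measurableSet_branch₃ p) h3 (g := g)
    fun u hu v hv => key u v 3 ((mem_branch₃_iff hp).1 hu) ((mem_branch₃_iff hp).1 hv)
  rw [setLIntegral_branches hp g μ, setLIntegral_branches hp g ν, lintegral_comp_letter hp]
  refine (add_le_add (add_le_add e1 e2) e3).trans (le_of_eq ?_)
  ring

/-- The length of the `n`-th return interval: the product of the first `n` parameters `αᵢ`. -/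
def returnLength (p : ℝ × ℝ) (n : ℕ) : ℝ := ∏ i ∈ Finset.range n, (gauss^[i] p).1

theorem returnLength_zero (p : ℝ × ℝ) : returnLength p 0 = 1 := rfl

theorem returnLength_succ (p : ℝ × ℝ) (n : ℕ) :
    returnLength p (n + 1) = p.1 * returnLength (gauss p) n := by
  rw [returnLength, Finset.prod_range_succ', mul_comm]
  rfl

theorem returnLength_succ' (p : ℝ × ℝ) (n : ℕ) :
    returnLength p (n + 1) = returnLength p n * (gauss^[n] p).1 :=
  Finset.prod_range_succ _ _

theorem IsRenormalizable.fst_pos (h : IsRenormalizable p) (n : ℕ) : 0 < (gauss^[n] p).1 := by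
  linarith [(h n).1, (h n).2.1]

theorem IsRenormalizable.returnLength_pos (h : IsRenormalizable p) (n : ℕ) :
    0 < returnLength p n := Finset.prod_pos fun i _ => h.fst_pos i

/-- The masses of the branches of the renormalized map are a function of those of the branches of
the map, since the abelianized substitution is invertible. -/
theorem comap_real_branch (hp : p ∈ paramRegion) {μ : Measure I} [IsFiniteMeasure μ]
    (hμ : MeasurePreserving (extMap p (paramRegion_subset hp)) μ μ) :
    (μ.comap (returnEmb p hp)).real (branch₁ (gauss p)) = μ.real (branch₂ p) ∧
    (μ.comap (returnEmb p hp)).real (branch₂ (gauss p)) =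
      μ.real (branch₁ p) - (⌊1 / p.1⌋₊ - 1) * μ.real (branch₃ p) ∧
    (μ.comap (returnEmb p hp)).real (branch₃ (gauss p)) =
      ⌊1 / p.1⌋₊ * μ.real (branch₃ p) - μ.real (branch₁ p) := by
  have h := eq_lift_comap hp hμ
  set d := μ.comap (returnEmb p hp) with hd
  have : IsFiniteMeasure d := by
    refine ⟨?_⟩
    rw [hd, (measurableEmbedding_returnEmb hp).comap_apply]
    exact measure_lt_top _ _
  have h1 := lift_real_branch₁ hp d
  have h2 := lift_real_branch₂ hp d
  have h3 := lift_real_branch₃ hp d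
  rw [← h] at h1 h2 h3
  refine ⟨h2.symm, ?_, ?_⟩
  · rw [h1, h3]; ring
  · rw [h1, h3]; ring

theorem SlowlyVarying.lintegral_le (n : ℕ) : ∀ {p : ℝ × ℝ} (hp : IsRenormalizable p)
    {g : I → ℝ≥0∞} (_ : Measurable g) {c : ℕ → ℝ≥0∞} {Λ : ℝ} (_ : 0 ≤ Λ)
    (_ : SlowlyVarying p g c Λ) {μ ν : Measure I} [IsFiniteMeasure μ] [IsFiniteMeasure ν]
    (_ : MeasurePreserving (extMap p (paramRegion_subset hp.mem)) μ μ)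
    (_ : MeasurePreserving (extMap p (paramRegion_subset hp.mem)) ν ν)
    (_ : μ.real (branch₁ p) = ν.real (branch₁ p)) (_ : μ.real (branch₂ p) = ν.real (branch₂ p))
    (_ : μ.real (branch₃ p) = ν.real (branch₃ p)),
    ∫⁻ x, g x ∂μ ≤ ∫⁻ x, g x ∂ν +
      ENNReal.ofReal (Λ * returnLength p n) * ∫⁻ x, c (letter p x) ∂μ := by
  induction n with
  | zero =>
    intro p hp g hg c Λ hΛ h μ ν _ _ hμ hν h1 h2 h3
    rw [returnLength_zero, mul_one]
    refine h.lintegral_le_of_branch_eq (paramRegion_subset hp.mem) hΛ ?_ ?_ ?_ <;>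
    rwa [Measure.real, Measure.real, ENNReal.toReal_eq_toReal_iff' (measure_ne_top _ _)
      (measure_ne_top _ _)] at *
  | succ n ih =>
    intro p hp g hg c Λ hΛ h μ ν _ _ hμ hν h1 h2 h3
    have em := measurableEmbedding_returnEmb hp.mem
    have : IsFiniteMeasure (μ.comap (returnEmb p hp.mem)) :=
      ⟨by rw [em.comap_apply]; exact measure_lt_top _ _⟩
    have : IsFiniteMeasure (ν.comap (returnEmb p hp.mem)) :=
      ⟨by rw [em.comap_apply]; exact measure_lt_top _ _⟩
    obtain ⟨a1, a2, a3⟩ := comap_real_branch hp.mem hμ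
    obtain ⟨b1, b2, b3⟩ := comap_real_branch hp.mem hν
    have hpos : 0 < p.1 := hp.fst_pos 0
    have hm : Measurable (TranslationMap.towerSum (extMap p (paramRegion_subset hp.mem))
        (returnEmb p hp.mem) (returnTime p) g) := by
      have e : (TranslationMap.towerSum (extMap p (paramRegion_subset hp.mem))
          (returnEmb p hp.mem) (returnTime p) g) = fun u =>
          ∑ j ∈ Finset.range (⌊1 / p.1⌋₊ + 1), {u | j < returnTime p u}.indicator
            (fun u => g ((extMap p (paramRegion_subset hp.mem))^[j] (returnEmb p hp.mem u))) u := by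
        ext u
        rw [TranslationMap.towerSum]
        have hle := returnTime_le hp.mem u
        refine (Finset.sum_congr rfl fun j hj => ?_).trans
          (Finset.sum_subset (Finset.range_mono hle) fun j _ hj => ?_)
        · rw [indicator_of_mem (by simpa using hj)]
        · rw [indicator_of_notMem (by simpa using hj)]
      rw [e]
      refine Finset.measurable_sum _ fun j _ => ?_
      refine (hg.comp (((measurable_extMap _).iterate j).comp em.measurable)).indicator ?_
      exact measurableSet_lt measurable_const (measurable_returnTime p)
    have key := ih hp.renorm hm (mul_nonneg hΛ hpos.le) (h.towerSum hp.mem)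
      (measurePreserving_comap_returnEmb hp.mem hμ) (measurePreserving_comap_returnEmb hp.mem hν)
      (by rw [a1, b1, h2]) (by rw [a2, b2, h1, h3]) (by rw [a3, b3, h1, h3])
    rwa [← lintegral_lift hp.mem _ hg, ← lintegral_lift hp.mem _ hg,
      ← lintegral_lift_comp_letter hp.mem, ← eq_lift_comap hp.mem hμ, ← eq_lift_comap hp.mem hν,
      mul_assoc, ← returnLength_succ] at key

/-- As long as `α > 1/2`, two renormalization steps multiply `1 - α` by `1 / (αᵢ αᵢ₊₁)`. -/
theorem one_sub_gauss_gauss (hp : p ∈ paramRegion) (h1 : 1 / 2 < p.1) :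
    (1 - (gauss (gauss p)).1) * (p.1 * (gauss p).1) = 1 - p.1 := by
  obtain ⟨h2, h3, h4⟩ := hp
  have hk : ⌊1 / p.1⌋₊ = 1 := by
    rw [Nat.floor_eq_iff (by positivity)]
    push_cast
    rw [le_div_iff₀ (by linarith), div_lt_iff₀ (by linarith)]
    constructor <;> linarith
  have h5 : p.1 ≠ 0 := by linarith
  simp only [gauss, hk]
  field_simp
  push_cast
  ring

theorem IsRenormalizable.iterate (h : IsRenormalizable p) (n : ℕ) :
    IsRenormalizable (gauss^[n] p) := fun m => by
  rw [← Function.iterate_add_apply]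
  exact h _

theorem IsRenormalizable.returnLength_le_one (h : IsRenormalizable p) (n : ℕ) :
    returnLength p n ≤ 1 :=
  Finset.prod_le_one (fun i _ => (h.fst_pos i).le) fun i _ => (h i).2.2.le

/-- If all `αᵢ` exceeded `1/2`, then the length of the return interval of level `2n`, times
`1 - α₂ₙ`, would be constant. So the lengths would stay away from zero, and the `αᵢ` of even index
away from `1`, which is contradictory. -/
theorem IsRenormalizable.exists_fst_le_half (h : IsRenormalizable p) :
    ∃ n, (gauss^[n] p).1 ≤ 1 / 2 := by
  by_contra! hcon
  have hid (n : ℕ) : (1 - (gauss^[2 * n] p).1) * returnLength p (2 * n) = 1 - p.1 := by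
    induction n with
    | zero => simp [returnLength_zero]
    | succ n ih =>
      have := one_sub_gauss_gauss (h (2 * n)) (hcon (2 * n))
      rw [← ih, ← this, show 2 * (n + 1) = 2 * n + 1 + 1 by ring, returnLength_succ',
        returnLength_succ', Function.iterate_succ_apply', Function.iterate_succ_apply']
      ring
  have he : 0 < 1 - p.1 := by linarith [h.mem.2.2]
  have hlow (n : ℕ) : 1 - p.1 ≤ 1 - (gauss^[2 * n] p).1 := by
    rw [← hid n]
    exact mul_le_of_le_one_right (by linarith [(h (2 * n)).2.2]) (h.returnLength_le_one _)
  have hup (n : ℕ) : returnLength p (2 * n) ≤ p.1 ^ n := by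
    induction n with
    | zero => simp [returnLength_zero]
    | succ n ih =>
      rw [show 2 * (n + 1) = 2 * n + 1 + 1 by ring, returnLength_succ', returnLength_succ',
        pow_succ]
      have a1 := (h (2 * n + 1)).2.2
      have a2 := h.fst_pos (2 * n + 1)
      have a3 := hlow n
      have a4 := h.fst_pos (2 * n)
      have a5 := (h.returnLength_pos (2 * n)).le
      calc _ ≤ returnLength p (2 * n) * (gauss^[2 * n] p).1 :=
            mul_le_of_le_one_right (by positivity) a1.le
        _ ≤ p.1 ^ n * p.1 :=
            mul_le_mul ih (by linarith) a4.le (pow_nonneg (h.fst_pos 0).le n)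
  have hge (n : ℕ) : 1 - p.1 ≤ p.1 ^ n := by
    refine le_trans ?_ (hup n)
    rw [← hid n]
    exact mul_le_of_le_one_left (h.returnLength_pos _).le (by linarith [h.fst_pos (2 * n)])
  have hlim := tendsto_pow_atTop_nhds_zero_of_lt_one (h.fst_pos 0).le h.mem.2.2
  exact absurd (ge_of_tendsto' hlim hge) (not_le.2 he)

theorem IsRenormalizable.frequently_fst_le_half (h : IsRenormalizable p) :
    ∃ᶠ n in atTop, (gauss^[n] p).1 ≤ 1 / 2 := by
  rw [frequently_atTop]
  intro N
  obtain ⟨n, hn⟩ := (h.iterate N).exists_fst_le_half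
  exact ⟨n + N, by omega, by rwa [Function.iterate_add_apply]⟩

theorem IsRenormalizable.tendsto_returnLength (h : IsRenormalizable p) :
    Tendsto (returnLength p) atTop (𝓝 0) := by
  have hanti : Antitone (returnLength p) := antitone_nat_of_succ_le fun n => by
    rw [returnLength_succ']
    exact mul_le_of_le_one_right (h.returnLength_pos n).le (h n).2.2.le
  have hbdd : BddBelow (range (returnLength p)) :=
    ⟨0, by rintro _ ⟨n, rfl⟩; exact (h.returnLength_pos n).le⟩
  have hlim := tendsto_atTop_ciInf hanti hbdd
  set l := ⨅ n, returnLength p n with hl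
  have hl0 : 0 ≤ l := le_ciInf fun n => (h.returnLength_pos n).le
  suffices l = 0 by rwa [this] at hlim
  by_contra hne
  have hlt : l < 2 * l := by
    have := lt_of_le_of_ne hl0 (Ne.symm hne)
    linarith
  obtain ⟨n, hn1, hn2⟩ := (h.frequently_fst_le_half.and_eventually
    (hlim.eventually_lt_const hlt)).exists
  have h1 : l ≤ returnLength p (n + 1) := ciInf_le hbdd _
  rw [returnLength_succ'] at h1
  have h2 := mul_le_mul_of_nonneg_left hn1 (h.returnLength_pos n).le
  linarith

theorem IsRenormalizable.lintegral_le_of_lipschitz (h : IsRenormalizable p)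
    {μ ν : Measure I} [IsFiniteMeasure μ] [IsFiniteMeasure ν]
    (hμ : MeasurePreserving (extMap p (paramRegion_subset h.mem)) μ μ)
    (hν : MeasurePreserving (extMap p (paramRegion_subset h.mem)) ν ν)
    (h1 : μ.real (branch₁ p) = ν.real (branch₁ p))
    (h2 : μ.real (branch₂ p) = ν.real (branch₂ p))
    (h3 : μ.real (branch₃ p) = ν.real (branch₃ p))
    {f : I → NNReal} {K : NNReal} (hf : LipschitzWith K f) :
    ∫⁻ x, f x ∂μ ≤ ∫⁻ x, f x ∂ν := by
  have hs : SlowlyVarying p (fun x => (f x : ℝ≥0∞)) (fun _ => 1) K := by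
    intro u v _
    rw [one_mul]
    have hd := hf.dist_le_mul u v
    rw [NNReal.dist_eq, Subtype.dist_eq, Real.dist_eq] at hd
    have h0 : (f u : ℝ) ≤ f v + K * |(u : ℝ) - v| := by
      linarith [le_abs_self ((f u : ℝ) - f v)]
    change (f u : ℝ≥0∞) ≤ f v + ENNReal.ofReal (K * |(u : ℝ) - v|)
    rw [← ENNReal.ofReal_coe_nnreal, ← ENNReal.ofReal_coe_nnreal (p := f v),
      ← ENNReal.ofReal_add (by positivity) (by positivity)]
    exact ENNReal.ofReal_le_ofReal h0
  have key (n : ℕ) := hs.lintegral_le n h hf.continuous.measurable.coe_nnreal_ennreal K.2 hμ hν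
    h1 h2 h3
  have hlim : Tendsto (fun n => ∫⁻ x, f x ∂ν +
      ENNReal.ofReal (K * returnLength p n) * ∫⁻ _, 1 ∂μ) atTop
      (𝓝 (∫⁻ x, f x ∂ν + ENNReal.ofReal (K * 0) * ∫⁻ _, 1 ∂μ)) := by
    refine Tendsto.const_add _ (ENNReal.Tendsto.mul_const ?_ (Or.inr (by simp)))
    exact ENNReal.tendsto_ofReal (h.tendsto_returnLength.const_mul _)
  simpa using ge_of_tendsto' hlim key

/-- The invariant measure of an infinitely renormalizable map is determined by its masses on the
branches: the floors of the towers are short, and the masses of the tower bases are determined. -/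
theorem IsRenormalizable.eq_of_real_branch_eq (h : IsRenormalizable p)
    {μ ν : Measure I} [IsFiniteMeasure μ] [IsFiniteMeasure ν]
    (hμ : MeasurePreserving (extMap p (paramRegion_subset h.mem)) μ μ)
    (hν : MeasurePreserving (extMap p (paramRegion_subset h.mem)) ν ν)
    (h1 : μ.real (branch₁ p) = ν.real (branch₁ p))
    (h2 : μ.real (branch₂ p) = ν.real (branch₂ p))
    (h3 : μ.real (branch₃ p) = ν.real (branch₃ p)) : μ = ν := by
  have hclosed (F : Set I) (hF : IsClosed F) : μ F = ν F := by
    have hpos (n : ℕ) : (0 : ℝ) < 1 / ((n : ℝ) + 1) := by positivity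
    have hlim := tendsto_one_div_add_atTop_nhds_zero_nat (𝕜 := ℝ)
    have e1 := tendsto_lintegral_thickenedIndicator_of_isClosed μ hF hpos hlim
    have e2 := tendsto_lintegral_thickenedIndicator_of_isClosed ν hF hpos hlim
    refine tendsto_nhds_unique e1 (e2.congr fun n => ?_)
    have hL := lipschitzWith_thickenedIndicator (hpos n) F
    exact le_antisymm (h.lintegral_le_of_lipschitz hν hμ h1.symm h2.symm h3.symm hL)
      (h.lintegral_le_of_lipschitz hμ hν h1 h2 h3 hL)
  refine ext_of_generate_finite _ (BorelSpace.measurable_eq.trans borel_eq_generateFrom_isClosed)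
    isPiSystem_isClosed (fun F hF => hclosed F hF) (hclosed univ isClosed_univ)

/-! ### The limit frequency set -/

theorem one_le_freqDenom {k : ℕ} (hk : 1 ≤ k) {q : ℝ × ℝ} (hq : q ∈ freqTriangle) :
    1 ≤ k * q.2 + q.1 := by
  obtain ⟨h1, h2, h3⟩ := hq
  have : (1 : ℝ) ≤ k := by exact_mod_cast hk
  nlinarith

theorem freqMap_mem {k : ℕ} (hk : 1 ≤ k) {q : ℝ × ℝ} (hq : q ∈ freqTriangle) :
    freqMap k q ∈ freqTriangle := by
  have hN := one_le_freqDenom hk hq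
  have hN0 : 0 < k * q.2 + q.1 := by linarith
  obtain ⟨h1, h2, h3⟩ := hq
  refine ⟨?_, ?_, ?_⟩
  · have : 0 ≤ q.2 / (k * q.2 + q.1) := div_nonneg (by linarith) hN0.le
    simp only [freqMap]
    linarith
  · simp only [freqMap]
    rwa [div_le_one hN0]
  · have : q.2 / (k * q.2 + q.1) ≤ 1 / (k * q.2 + q.1) := by gcongr
    simp only [freqMap]
    linarith

/-- The inverse of `freqMap k` on the triangle. -/
def freqInv (k : ℕ) (q : ℝ × ℝ) : ℝ × ℝ := ((1 - k * (1 - q.1)) / q.2, (1 - q.1) / q.2)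

theorem freqInv_freqMap {k : ℕ} (hk : 1 ≤ k) {q : ℝ × ℝ} (hq : q ∈ freqTriangle) :
    freqInv k (freqMap k q) = q := by
  have hN : k * q.2 + q.1 ≠ 0 := by linarith [one_le_freqDenom hk hq]
  simp only [freqInv, freqMap]
  apply Prod.ext
  · field_simp
    ring
  · rw [sub_sub_cancel, div_div_div_cancel_right₀ hN, div_one]

theorem freqComp_succ' (k : ℕ → ℕ) (n : ℕ) :
    freqComp k (n + 1) = freqMap (k 0) ∘ freqComp (fun i => k (i + 1)) n := by
  induction n with
  | zero => rfl
  | succ n ih =>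
    rw [freqComp, ih]
    rfl

theorem freqComp_mem {k : ℕ → ℕ} (hk : ∀ i, 1 ≤ k i) (n : ℕ) {q : ℝ × ℝ}
    (hq : q ∈ freqTriangle) : freqComp k n q ∈ freqTriangle := by
  induction n generalizing q with
  | zero => exact hq
  | succ n ih => exact ih (freqMap_mem (hk n) hq)

theorem code_zero (p : ℝ × ℝ) : code p 0 = ⌊1 / p.1⌋₊ := rfl

theorem IsRenormalizable.one_le_code (h : IsRenormalizable p) (n : ℕ) : 1 ≤ code p n :=
  one_le_floor (h n)

theorem IsRenormalizable.limitSet_subset (h : IsRenormalizable p) :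
    limitSet p ⊆ freqTriangle := by
  intro q hq
  obtain ⟨s, hs, rfl⟩ := mem_iInter.1 hq 0
  exact freqComp_mem h.one_le_code 1 hs

theorem IsRenormalizable.exists_freqMap_eq (h : IsRenormalizable p) {q : ℝ × ℝ}
    (hq : q ∈ limitSet p) : ∃ q' ∈ limitSet (gauss p), freqMap (code p 0) q' = q := by
  have hex (i : ℕ) : ∃ s ∈ freqTriangle,
      freqMap (code p 0) (freqComp (code (gauss p)) (i + 1) s) = q := by
    obtain ⟨s, hs, hsq⟩ := mem_iInter.1 hq (i + 1)
    rw [freqComp_succ'] at hsq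
    exact ⟨s, hs, hsq⟩
  choose s hs hsq using hex
  have hmem (i : ℕ) : freqComp (code (gauss p)) (i + 1) (s i) ∈ freqTriangle :=
    freqComp_mem h.renorm.one_le_code _ (hs i)
  have heq (i : ℕ) : freqComp (code (gauss p)) (i + 1) (s i) = freqInv (code p 0) q := by
    rw [← hsq i, freqInv_freqMap (h.one_le_code 0) (hmem i)]
  refine ⟨freqInv (code p 0) q, mem_iInter.2 fun i => ⟨s i, hs i, heq i⟩, ?_⟩
  rw [← heq 0, hsq 0]

/-- A sequence of frequency vectors, one for each renormalization, that are mapped to each other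
by the frequency maps. -/
structure IsFreqOrbit (p : ℝ × ℝ) (q : ℕ → ℝ × ℝ) : Prop where
  mem : ∀ n, q n ∈ freqTriangle
  map : ∀ n, freqMap (code p n) (q (n + 1)) = q n

theorem IsFreqOrbit.tail {q : ℕ → ℝ × ℝ} (h : IsFreqOrbit p q) :
    IsFreqOrbit (gauss p) (fun n => q (n + 1)) :=
  ⟨fun n => h.mem (n + 1), fun n => h.map (n + 1)⟩

theorem IsRenormalizable.exists_isFreqOrbit (h : IsRenormalizable p) {q : ℝ × ℝ}
    (hq : q ∈ limitSet p) : ∃ s : ℕ → ℝ × ℝ, s 0 = q ∧ IsFreqOrbit p s := by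
  have step (n : ℕ) (a : limitSet (gauss^[n] p)) :
      ∃ b : limitSet (gauss^[n + 1] p), freqMap (code p n) b = a := by
    obtain ⟨b, hb, hba⟩ := (h.iterate n).exists_freqMap_eq a.2
    rw [← Function.iterate_succ_apply' (f := gauss)] at hb
    exact ⟨⟨b, hb⟩, hba⟩
  choose f hf using step
  let s (n : ℕ) : limitSet (gauss^[n] p) :=
    Nat.rec (motive := fun n => limitSet (gauss^[n] p)) ⟨q, hq⟩ (fun n a => f n a) n
  exact ⟨fun n => s n, rfl, fun n => (h.iterate n).limitSet_subset (s n).2, fun n => hf n (s n)⟩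

/-- The total mass of the base of the `n`-th tower, when the total mass of the tower is `1`. -/
def baseMass (q : ℕ → ℝ × ℝ) (n : ℕ) : ℝ := ∏ i ∈ Finset.range n, (q i).2

theorem baseMass_succ (q : ℕ → ℝ × ℝ) (n : ℕ) :
    baseMass q (n + 1) = baseMass q n * (q n).2 := Finset.prod_range_succ _ _

theorem baseMass_succ' (q : ℕ → ℝ × ℝ) (n : ℕ) :
    baseMass q (n + 1) = (q 0).2 * baseMass (fun i => q (i + 1)) n := by
  rw [baseMass, Finset.prod_range_succ', mul_comm]
  rfl

namespace IsFreqOrbit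

variable {q : ℕ → ℝ × ℝ}

theorem snd_eq (hq : IsFreqOrbit p q) (n : ℕ) :
    (q n).2 = 1 / (code p n * (q (n + 1)).2 + (q (n + 1)).1) := by
  rw [← hq.map n]
  rfl

theorem snd_pos (hq : IsFreqOrbit p q) (h : IsRenormalizable p) (n : ℕ) : 0 < (q n).2 := by
  rw [hq.snd_eq]
  have := one_le_freqDenom (h.one_le_code n) (hq.mem (n + 1))
  positivity

theorem snd_mul (hq : IsFreqOrbit p q) (h : IsRenormalizable p) (n : ℕ) :
    (q n).2 * (code p n * (q (n + 1)).2 + (q (n + 1)).1) = 1 := by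
  rw [hq.snd_eq]
  have := one_le_freqDenom (h.one_le_code n) (hq.mem (n + 1))
  field_simp

theorem baseMass_pos (hq : IsFreqOrbit p q) (h : IsRenormalizable p) (n : ℕ) :
    0 < baseMass q n := Finset.prod_pos fun i _ => hq.snd_pos h i

theorem baseMass_le_one (hq : IsFreqOrbit p q) (h : IsRenormalizable p) (n : ℕ) :
    baseMass q n ≤ 1 :=
  Finset.prod_le_one (fun i _ => (hq.snd_pos h i).le) fun i _ => (hq.mem i).2.1

/-- The masses of the tower bases tend to zero: otherwise the ratios `ηᵢ` of consecutive masses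
would tend to `1`, although `ηᵢ (1 + ηᵢ₊₁) ≤ 1` for the infinitely many `i` with `kᵢ ≥ 2`. -/
theorem tendsto_baseMass (hq : IsFreqOrbit p q) (h : IsRenormalizable p) :
    Tendsto (baseMass q) atTop (𝓝 0) := by
  have hanti : Antitone (baseMass q) := antitone_nat_of_succ_le fun n => by
    rw [baseMass_succ]
    exact mul_le_of_le_one_right (hq.baseMass_pos h n).le (hq.mem n).2.1
  have hbdd : BddBelow (range (baseMass q)) :=
    ⟨0, by rintro _ ⟨n, rfl⟩; exact (hq.baseMass_pos h n).le⟩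
  have hlim := tendsto_atTop_ciInf hanti hbdd
  set l := ⨅ n, baseMass q n with hl
  suffices l = 0 by rwa [this] at hlim
  by_contra hne
  have hlim1 : Tendsto (fun n => (q n).2) atTop (𝓝 1) := by
    have h1 := ((tendsto_add_atTop_iff_nat 1).2 hlim).div hlim hne
    rw [div_self hne] at h1
    refine h1.congr fun n => ?_
    have := (hq.baseMass_pos h n).ne'
    rw [Pi.div_apply, baseMass_succ]
    field_simp
  have hlim2 := (tendsto_add_atTop_iff_nat 1).2 hlim1
  have hlim3 : Tendsto (fun n => (q n).2 * (q (n + 1)).2 + (q n).2) atTop (𝓝 (1 * 1 + 1)) :=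
    (hlim1.mul hlim2).add hlim1
  obtain ⟨n, hn1, hn2⟩ := (h.frequently_fst_le_half.and_eventually
    (hlim3.eventually_const_lt (show (1 : ℝ) < 1 * 1 + 1 by norm_num))).exists
  have hk : (2 : ℝ) ≤ code p n := by
    have : 2 ≤ code p n := by
      rw [code, Nat.le_floor_iff' (by norm_num), le_div_iff₀ (h.fst_pos n)]
      push_cast
      linarith
    exact_mod_cast this
  have h1 := hq.snd_mul h n
  have h2 := (hq.mem (n + 1)).2.2
  have h3 := hq.snd_pos h n
  have h4 := hq.snd_pos h (n + 1)
  have h5 : (q n).2 * ((q (n + 1)).2 + 1) ≤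
      (q n).2 * (code p n * (q (n + 1)).2 + (q (n + 1)).1) := by
    refine mul_le_mul_of_nonneg_left ?_ h3.le
    nlinarith
  linarith

end IsFreqOrbit

/-- Twice the signed area of the triangle with vertices `a`, `b`, `c`. -/
def signedArea (a b c : ℝ × ℝ) : ℝ := (b.1 - a.1) * (c.2 - a.2) - (b.2 - a.2) * (c.1 - a.1)

theorem signedArea_freqMap {k : ℕ} (hk : 1 ≤ k) {a b c : ℝ × ℝ} (ha : a ∈ freqTriangle)
    (hb : b ∈ freqTriangle) (hc : c ∈ freqTriangle) :
    signedArea (freqMap k a) (freqMap k b) (freqMap k c) =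
      -((freqMap k a).2 * (freqMap k b).2 * (freqMap k c).2 * signedArea a b c) := by
  have hdenom {q : ℝ × ℝ} (hq : q ∈ freqTriangle) :
      ∃ N : ℝ, N ≠ 0 ∧ k * q.2 + q.1 = N ∧ q.1 = N - k * q.2 :=
    ⟨k * q.2 + q.1, by linarith [one_le_freqDenom hk hq], rfl, by ring⟩
  obtain ⟨A, hA0, hA, hA'⟩ := hdenom ha
  obtain ⟨B, hB0, hB, hB'⟩ := hdenom hb
  obtain ⟨C, hC0, hC, hC'⟩ := hdenom hc
  simp only [signedArea, freqMap, hA, hB, hC]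
  rw [hA', hB', hC']
  field_simp
  ring

theorem abs_signedArea_le {a b c : ℝ × ℝ} (ha : a ∈ freqTriangle)
    (hb : b ∈ freqTriangle) (hc : c ∈ freqTriangle) : |signedArea a b c| ≤ 2 := by
  obtain ⟨a1, a2, a3⟩ := ha
  obtain ⟨b1, b2, b3⟩ := hb
  obtain ⟨c1, c2, c3⟩ := hc
  have key (x y z w : ℝ) (hx : |x| ≤ 1) (hy : |y| ≤ 1) (hz : |z| ≤ 1) (hw : |w| ≤ 1) :
      |x * y - z * w| ≤ 2 := by
    have h1 := mul_le_mul hx hy (abs_nonneg _) zero_le_one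
    have h2 := mul_le_mul hz hw (abs_nonneg _) zero_le_one
    rw [← abs_mul] at h1 h2
    linarith [abs_sub (x * y) (z * w)]
  apply key <;> rw [abs_le] <;> constructor <;> linarith

/-- The limit set is contained in a line: the area of a triangle with vertices in it is that of the
renormalized triangle times the masses of the three tower bases. -/
theorem IsRenormalizable.signedArea_eq_zero (h : IsRenormalizable p) {a b c : ℝ × ℝ}
    (ha : a ∈ limitSet p) (hb : b ∈ limitSet p) (hc : c ∈ limitSet p) :
    signedArea a b c = 0 := by
  obtain ⟨a, rfl, hao⟩ := h.exists_isFreqOrbit ha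
  obtain ⟨b, rfl, hbo⟩ := h.exists_isFreqOrbit hb
  obtain ⟨c, rfl, hco⟩ := h.exists_isFreqOrbit hc
  have hrec (n : ℕ) : |signedArea (a 0) (b 0) (c 0)| =
      baseMass a n * (baseMass b n * baseMass c n * |signedArea (a n) (b n) (c n)|) := by
    induction n with
    | zero => simp [baseMass]
    | succ n ih =>
      have := signedArea_freqMap (h.one_le_code n) (hao.mem (n + 1)) (hbo.mem (n + 1))
        (hco.mem (n + 1))
      rw [hao.map, hbo.map, hco.map] at this
      rw [ih, this, abs_neg, abs_mul, abs_mul, abs_mul, abs_of_pos (hao.snd_pos h n),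
        abs_of_pos (hbo.snd_pos h n), abs_of_pos (hco.snd_pos h n), baseMass_succ, baseMass_succ,
        baseMass_succ]
      ring
  have hle (n : ℕ) : |signedArea (a 0) (b 0) (c 0)| ≤ baseMass a n * (1 * 1 * 2) := by
    rw [hrec n]
    have h1 := (hao.baseMass_pos h n).le
    have h2 := (hbo.baseMass_pos h n).le
    have h3 := (hco.baseMass_pos h n).le
    have h4 := hbo.baseMass_le_one h n
    have h5 := hco.baseMass_le_one h n
    have h6 := abs_signedArea_le (hao.mem n) (hbo.mem n) (hco.mem n)
    gcongr
  have hlim := (hao.tendsto_baseMass h).mul_const (1 * 1 * 2)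
  rw [zero_mul] at hlim
  exact abs_nonpos_iff.1 (ge_of_tendsto' hlim hle)

theorem collinear_of_signedArea_eq_zero {a b c : ℝ × ℝ} (hab : b ≠ a)
    (h : signedArea a b c = 0) : Collinear ℝ {a, b, c} := by
  rw [collinear_iff_of_mem (p₀ := a) (by simp)]
  refine ⟨b - a, ?_⟩
  unfold signedArea at h
  have hc : ∃ r : ℝ, c = r • (b - a) + a := by
    by_cases h1 : b.1 - a.1 = 0
    · have h2 : b.2 - a.2 ≠ 0 := fun h2 => hab (Prod.ext (sub_eq_zero.1 h1) (sub_eq_zero.1 h2))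
      have h3 : c.1 - a.1 = 0 := by
        rw [h1, zero_mul, zero_sub, neg_eq_zero] at h
        exact (mul_eq_zero.1 h).resolve_left h2
      refine ⟨(c.2 - a.2) / (b.2 - a.2), Prod.ext ?_ ?_⟩
      · simp [h1]; linarith
      · simp; field_simp; ring
    · refine ⟨(c.1 - a.1) / (b.1 - a.1), Prod.ext ?_ ?_⟩
      · simp; field_simp; ring
      · simp; field_simp; linarith
  rintro x (rfl | rfl | rfl)
  · exact ⟨0, by simp⟩
  · exact ⟨1, by simp⟩
  · exact hc

theorem IsRenormalizable.encard_extremePoints_le (h : IsRenormalizable p) :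
    (extremePoints ℝ (limitSet p)).encard ≤ 2 := by
  by_contra! hcon
  have h3 : (3 : ℕ∞) ≤ (extremePoints ℝ (limitSet p)).encard :=
    Order.add_one_le_of_lt hcon
  obtain ⟨t, ht, ht3⟩ := exists_subset_encard_eq h3
  obtain ⟨a, b, c, hab, hac, hbc, rfl⟩ := encard_eq_three.1 ht3
  have ha := mem_extremePoints_iff_forall_segment.1 (ht (by simp : a ∈ _))
  have hb := mem_extremePoints_iff_forall_segment.1 (ht (by simp : b ∈ _))
  have hc := mem_extremePoints_iff_forall_segment.1 (ht (by simp : c ∈ _))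
  have hcol := collinear_of_signedArea_eq_zero hab.symm (h.signedArea_eq_zero ha.1 hb.1 hc.1)
  rcases hcol.wbtw_or_wbtw_or_wbtw with hw | hw | hw
  · rcases hb.2 _ ha.1 _ hc.1 (mem_segment_iff_wbtw.2 hw) with e | e
    · exact hab e
    · exact hbc e.symm
  · rcases hc.2 _ hb.1 _ ha.1 (mem_segment_iff_wbtw.2 hw) with e | e
    · exact hbc e
    · exact hac e
  · rcases ha.2 _ hc.1 _ hb.1 (mem_segment_iff_wbtw.2 hw) with e | e
    · exact hac e.symm
    · exact hab e.symm

/-! ### Existence of an invariant measure with given frequencies -/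

/-- The part of `[0,1)` between two real numbers, the left one included. -/
def seg (s t : ℝ) : Set I := {y | s ≤ (y : ℝ) ∧ (y : ℝ) < t}

theorem measurableSet_seg (s t : ℝ) : MeasurableSet (seg s t) :=
  measurable_subtype_coe measurableSet_Ico

theorem branch₁_eq_seg (p : ℝ × ℝ) : branch₁ p = seg 0 (1 - p.1) := by
  ext y
  simp [branch₁, seg, y.2.1]

theorem branch₂_eq_seg (p : ℝ × ℝ) : branch₂ p = seg (1 - p.1) (1 - p.2) := rfl

theorem branch₃_eq_seg (p : ℝ × ℝ) : branch₃ p = seg (1 - p.2) 1 := by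
  ext y
  simp [branch₃, seg, y.2.2]

/-- The approximations: measures with the prescribed frequencies, supported on the towers of level
`n`, for which the defect of invariance is at most the mass of the base of these towers. -/
theorem IsFreqOrbit.exists_approx (n : ℕ) : ∀ {p : ℝ × ℝ} (hp : IsRenormalizable p)
    {q : ℕ → ℝ × ℝ} (_ : IsFreqOrbit p q), ∃ μ : Measure I, IsProbabilityMeasure μ ∧
      μ.real (branch₁ p) = 1 - (q 0).2 ∧ μ.real (branch₂ p) = (q 0).1 + (q 0).2 - 1 ∧
      μ.real (branch₃ p) = 1 - (q 0).1 ∧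
      (∀ A, MeasurableSet A →
        |μ.real (extMap p (paramRegion_subset hp.mem) ⁻¹' A) - μ.real A| ≤ baseMass q n) ∧
      ∀ m ≤ n, μ.real (seg (1 - returnLength p m) 1) ≤ baseMass q m := by
  induction n with
  | zero =>
    intro p hp q hq
    obtain ⟨h1, h2, h3⟩ := hp.mem
    obtain ⟨q1, q2, q3⟩ := hq.mem 0
    set x₁ : I := ⟨0, by constructor <;> linarith⟩ with hx₁
    set x₂ : I := ⟨1 - p.1, by constructor <;> linarith⟩ with hx₂
    set x₃ : I := ⟨1 - p.2, by constructor <;> linarith⟩ with hx₃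
    let μ : Measure I := ENNReal.ofReal (1 - (q 0).2) • Measure.dirac x₁ +
      ENNReal.ofReal ((q 0).1 + (q 0).2 - 1) • Measure.dirac x₂ +
      ENNReal.ofReal (1 - (q 0).1) • Measure.dirac x₃
    have e1 : μ (branch₁ p) = ENNReal.ofReal (1 - (q 0).2) := by
      have a1 : x₁ ∈ branch₁ p := show (0 : ℝ) < 1 - p.1 by linarith
      have a2 : x₂ ∉ branch₁ p := not_lt.2 (show 1 - p.1 ≤ (1 - p.1 : ℝ) from le_rfl)
      have a3 : x₃ ∉ branch₁ p := not_lt.2 (show 1 - p.1 ≤ (1 - p.2 : ℝ) by linarith)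
      simp [μ, a1, a2, a3, Measure.dirac_apply' _ (measurableSet_branch₁ p)]
    have e2 : μ (branch₂ p) = ENNReal.ofReal ((q 0).1 + (q 0).2 - 1) := by
      have a1 : x₁ ∉ branch₂ p := fun h =>
        absurd h.1 (not_le.2 (show (0 : ℝ) < 1 - p.1 by linarith))
      have a2 : x₂ ∈ branch₂ p :=
        ⟨le_rfl, show (1 - p.1 : ℝ) < 1 - p.2 by linarith⟩
      have a3 : x₃ ∉ branch₂ p := fun h => absurd h.2 (lt_irrefl _)
      simp [μ, a1, a2, a3, Measure.dirac_apply' _ (measurableSet_branch₂ p)]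
    have e3 : μ (branch₃ p) = ENNReal.ofReal (1 - (q 0).1) := by
      have a1 : x₁ ∉ branch₃ p := not_le.2 (show (0 : ℝ) < 1 - p.2 by linarith)
      have a2 : x₂ ∉ branch₃ p := not_le.2 (show (1 - p.1 : ℝ) < 1 - p.2 by linarith)
      have a3 : x₃ ∈ branch₃ p := show (1 - p.2 : ℝ) ≤ 1 - p.2 from le_rfl
      simp [μ, a1, a2, a3, Measure.dirac_apply' _ (measurableSet_branch₃ p)]
    have hprob : IsProbabilityMeasure μ := by
      refine ⟨?_⟩
      rw [measure_univ_eq_add_branch (paramRegion_subset hp.mem), e1, e2, e3,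
        ← ENNReal.ofReal_add (by linarith) (by linarith),
        ← ENNReal.ofReal_add (by linarith) (by linarith), ← ENNReal.ofReal_one]
      congr 1
      ring
    refine ⟨μ, hprob, ?_, ?_, ?_, fun A _ => ?_, fun m hm => ?_⟩
    · rw [Measure.real, e1, ENNReal.toReal_ofReal (by linarith)]
    · rw [Measure.real, e2, ENNReal.toReal_ofReal (by linarith)]
    · rw [Measure.real, e3, ENNReal.toReal_ofReal (by linarith)]
    · have b1 : μ.real A ≤ 1 := measureReal_le_one
      have b2 : μ.real (extMap p (paramRegion_subset hp.mem) ⁻¹' A) ≤ 1 := measureReal_le_one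
      have b3 : 0 ≤ μ.real A := measureReal_nonneg
      have b4 : 0 ≤ μ.real (extMap p (paramRegion_subset hp.mem) ⁻¹' A) := measureReal_nonneg
      simp only [baseMass, Finset.range_zero, Finset.prod_empty]
      rw [abs_le]
      constructor <;> linarith
    · obtain rfl : m = 0 := by omega
      exact measureReal_le_one
  | succ n ih =>
    intro p hp q hq
    obtain ⟨d, hd, d1, d2, d3, d4, d5⟩ := ih hp.renorm hq.tail
    have hηpos := hq.snd_pos hp 0
    have hN := hq.snd_mul hp 0
    have hξ : (q 0).1 = 1 - (q 1).2 * (q 0).2 := by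
      rw [hq.snd_eq 0]
      conv_lhs => rw [← hq.map 0]
      simp only [freqMap]
      ring
    rw [code_zero] at hN
    have := isFiniteMeasure_lift hp.mem d
    set μ : Measure I := ENNReal.ofReal (q 0).2 • lift p hp.mem d with hμ
    have hμr (A : Set I) : μ.real A = (q 0).2 * (lift p hp.mem d).real A := by
      rw [hμ, measureReal_ennreal_smul_apply, ENNReal.toReal_ofReal hηpos.le]
    have e1 : μ.real (branch₁ p) = 1 - (q 0).2 := by
      rw [hμr, lift_real_branch₁, d2, d3]
      linarith
    have e2 : μ.real (branch₂ p) = (q 0).1 + (q 0).2 - 1 := by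
      rw [hμr, lift_real_branch₂, d1, hξ]
      ring
    have e3 : μ.real (branch₃ p) = 1 - (q 0).1 := by
      rw [hμr, lift_real_branch₃, d2, d3, hξ]
      ring
    have hfin : IsFiniteMeasure μ := by
      rw [hμ]; exact Measure.smul_finite _ ENNReal.ofReal_ne_top
    have hprob : IsProbabilityMeasure μ := by
      have h1 := measureReal_univ_eq_add_branch (paramRegion_subset hp.mem) μ
      rw [e1, e2, e3] at h1
      refine ⟨?_⟩
      rw [← ENNReal.toReal_eq_one_iff]
      rw [Measure.real] at h1
      linarith
    refine ⟨μ, hprob, e1, e2, e3, fun A hA => ?_, fun m hm => ?_⟩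
    · have em := measurableEmbedding_returnEmb hp.mem
      have h1 := congrArg ENNReal.toReal (towerMeasure_preimage
        (measurable_extMap (paramRegion_subset hp.mem)) em.measurable
        (measurable_returnTime p) (returnEmb_extMap_gauss hp.mem) (measurable_extMap _) d hA)
      change (lift p hp.mem d _ + _).toReal = (lift p hp.mem d _ + _).toReal at h1
      rw [ENNReal.toReal_add (measure_ne_top _ _) (measure_ne_top _ _),
        ENNReal.toReal_add (measure_ne_top _ _) (measure_ne_top _ _)] at h1
      have h2 := d4 _ (em.measurable hA)
      rw [hμr, hμr, ← mul_sub, abs_mul, abs_of_pos hηpos, baseMass_succ']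
      refine mul_le_mul_of_nonneg_left ?_ hηpos.le
      refine le_trans (le_of_eq ?_) h2
      congr 1
      simp only [Measure.real]
      linarith
    · rcases m with _ | m
      · rw [baseMass, Finset.range_zero, Finset.prod_empty]
        exact measureReal_le_one
      · rw [hμr, baseMass_succ']
        refine mul_le_mul_of_nonneg_left ?_ hηpos.le
        have hpos : 0 < p.1 := hp.fst_pos 0
        have hsub : seg (1 - returnLength p (m + 1)) 1 ⊆ range (returnEmb p hp.mem) := by
          intro x hx
          rw [range_returnEmb, branch₁, mem_compl_iff, mem_ofPred_eq, not_lt]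
          refine le_trans ?_ hx.1
          rw [returnLength_succ]
          have := mul_le_of_le_one_right hpos.le (hp.renorm.returnLength_le_one m)
          linarith
        have hpre : returnEmb p hp.mem ⁻¹' seg (1 - returnLength p (m + 1)) 1 =
            seg (1 - returnLength (gauss p) m) 1 := by
          ext u
          simp only [seg, mem_preimage, mem_ofPred_eq, returnLength_succ]
          refine and_congr ?_ (iff_of_true (returnEmb p hp.mem u).2.2 u.2.2)
          rw [coe_returnEmb, ← mul_le_mul_iff_right₀ (b := 1 - returnLength (gauss p) m) hpos]
          constructor <;> intro h <;> linarith
        rw [Measure.real, lift, towerMeasure_apply_of_subset_range (measurable_extMap _)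
          (measurableEmbedding_returnEmb hp.mem).measurable (returnTime_pos hp.mem)
          (iterate_notMem_range_returnEmb hp.mem) d (measurableSet_seg _ _) hsub, hpre]
        exact d5 m (by omega)

/-- Every orbit meets the return interval of level `m` within a bounded time. -/
theorem IsRenormalizable.exists_iterate_ge (m : ℕ) : ∀ {p : ℝ × ℝ} (hp : IsRenormalizable p),
    ∃ N, ∀ x, ∃ j ≤ N,
      1 - returnLength p m ≤ ((extMap p (paramRegion_subset hp.mem))^[j] x : ℝ) := by
  induction m with
  | zero =>
    intro p hp
    refine ⟨0, fun x => ⟨0, le_rfl, ?_⟩⟩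
    rw [returnLength_zero, sub_self]
    exact x.2.1
  | succ m ih =>
    intro p hp
    obtain ⟨N, hN⟩ := ih hp.renorm
    refine ⟨N * (⌊1 / p.1⌋₊ + 1) + ⌊1 / p.1⌋₊, fun x => ?_⟩
    obtain ⟨i, hi, u, hu⟩ := exists_iterate_mem_range_returnEmb hp.mem x
    obtain ⟨j, hj, hju⟩ := hN u
    obtain ⟨t, -, ht, htu⟩ := exists_iterate_returnEmb hp.mem u j
    refine ⟨t + i, add_le_add (ht.trans (Nat.mul_le_mul_right _ hj)) hi, ?_⟩
    rw [Function.iterate_add_apply, ← hu, ← htu, coe_returnEmb, returnLength_succ]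
    have := mul_le_mul_of_nonneg_left hju (hp.fst_pos 0).le
    simp only [Function.iterate_zero, id] at this
    linarith

/-- Outside a finite set of cut points, whole segments follow the orbit of their left end point
until it reaches a given segment `[l, 1)`. -/
theorem exists_finite_cuts (hp : p ∈ paramRegion) (l : ℝ) (N : ℕ) :
    ∃ D : Set ℝ, D.Finite ∧ ∀ (x : I) (b : ℝ), Disjoint (Ioo (x : ℝ) b) D →
      (∃ j ≤ N, l ≤ ((extMap p (paramRegion_subset hp))^[j] x : ℝ)) →
      ∃ j ≤ N, ∀ y ∈ seg x b, l ≤ ((extMap p (paramRegion_subset hp))^[j] y : ℝ) := by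
  induction N with
  | zero =>
    refine ⟨∅, finite_empty, fun x b _ ⟨j, hj, hx⟩ => ⟨j, hj, fun y hy => ?_⟩⟩
    obtain rfl : j = 0 := by omega
    exact hx.trans hy.1
  | succ N ih =>
    obtain ⟨D, hD, hDx⟩ := ih
    refine ⟨{1 - p.1, 1 - p.2} ∪ ((fun d => d - p.1) '' D ∪
      ((fun d => d - p.2) '' D ∪ (fun d => d - (p.2 - 1)) '' D)),
      (toFinite _).union ((hD.image _).union ((hD.image _).union (hD.image _))), ?_⟩
    intro x b hdisj hx
    rw [Set.disjoint_left] at hdisj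
    obtain ⟨j, hj, hxj⟩ := hx
    rcases j with _ | j
    · exact ⟨0, by omega, fun y hy => hxj.trans hy.1⟩
    · set x' := extMap p (paramRegion_subset hp) x with hx'
      have hletter (y : I) (hy : y ∈ seg x b) : letter p x = letter p y := by
        have c1 : ¬ ((x : ℝ) < 1 - p.1 ∧ 1 - p.1 < b) := fun h => hdisj h (by simp)
        have c2 : ¬ ((x : ℝ) < 1 - p.2 ∧ 1 - p.2 < b) := fun h => hdisj h (by simp)
        obtain ⟨y1, y2⟩ := hy
        unfold letter
        split_ifs <;> first | rfl | (exfalso; first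
          | exact c1 ⟨by linarith, by linarith⟩
          | exact c2 ⟨by linarith, by linarith⟩)
      have hshift : (x' : ℝ) - x = p.1 ∨ (x' : ℝ) - x = p.2 ∨ (x' : ℝ) - x = p.2 - 1 := by
        rw [hx', coe_extMap, mapFormula]
        split_ifs
        · left; ring
        · right; left; ring
        · right; right; ring
      have hdisj' : Disjoint (Ioo (x' : ℝ) (b + (x' - x))) D := by
        rw [Set.disjoint_left]
        intro d hd hdD
        refine hdisj (a := d - (x' - x)) ⟨by linarith [hd.1], by linarith [hd.2]⟩ ?_
        rcases hshift with h | h | h <;> rw [h]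
        · exact Or.inr (Or.inl ⟨d, hdD, rfl⟩)
        · exact Or.inr (Or.inr (Or.inl ⟨d, hdD, rfl⟩))
        · exact Or.inr (Or.inr (Or.inr ⟨d, hdD, rfl⟩))
      obtain ⟨i, hi, hiy⟩ := hDx x' (b + (x' - x)) hdisj' ⟨j, by omega, hxj⟩
      refine ⟨i + 1, by omega, fun y hy => hiy _ ?_⟩
      have h1 := extMap_sub_extMap (paramRegion_subset hp) (hletter y hy)
      constructor
      · linarith [hy.1]
      · linarith [hy.2]

/-- A finitely additive probability on `[0,1)` that is uniformly small on short segments agrees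
with a measure on segments. -/
theorem exists_measure_of_content (c : Set I → ℝ)
    (hadd : ∀ A B, MeasurableSet A → MeasurableSet B → Disjoint A B → c (A ∪ B) = c A + c B)
    (hnn : ∀ A, 0 ≤ c A) (huniv : c univ = 1)
    (hsmall : ∀ ε > 0, ∃ D : Set ℝ, D.Finite ∧ ∀ s t, Disjoint (Ioo s t) D → c (seg s t) ≤ ε) :
    ∃ μ : Measure I, IsProbabilityMeasure μ ∧ ∀ s t, μ.real (seg s t) = c (seg s t) := by
  have hempty : c ∅ = 0 := by
    have := hadd ∅ ∅ .empty .empty (disjoint_empty _)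
    rw [union_empty] at this
    linarith
  set F : ℝ → ℝ := fun t => c {y : I | (y : ℝ) < t} with hF
  have hFadd (s t : ℝ) (hst : s ≤ t) : F t = F s + c (seg s t) := by
    change c {y : I | (y : ℝ) < t} = c {y : I | (y : ℝ) < s} + c (seg s t)
    rw [← hadd {y : I | (y : ℝ) < s} _ (measurable_subtype_coe measurableSet_Iio) (measurableSet_seg s t)]
    · congr 1
      ext y
      simp only [mem_ofPred_eq, seg, mem_union]
      constructor
      · intro h
        rcases lt_or_ge (y : ℝ) s with h' | h'
        · exact Or.inl h'
        · exact Or.inr ⟨h', h⟩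
      · rintro (h | h)
        · linarith
        · exact h.2
    · rw [Set.disjoint_left]
      intro y h1 h2
      exact absurd h2.1 (not_le.2 h1)
  have hmono : Monotone F := fun s t hst => by
    rw [hFadd s t hst]
    linarith [hnn (seg s t)]
  have hcont : Continuous F := by
    rw [continuous_iff_continuousAt]
    intro t
    rw [Metric.continuousAt_iff]
    intro ε hε
    obtain ⟨D, hD, hDs⟩ := hsmall (ε / 2) (by linarith)
    have hopen : IsOpen (D \ {t})ᶜ := (hD.subset sdiff_subset).isClosed.isOpen_compl
    obtain ⟨δ, hδ, hball⟩ := Metric.isOpen_iff.1 hopen t (by simp)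
    refine ⟨δ, hδ, fun {s} hs => ?_⟩
    have hcut (z : ℝ) (hz : dist z t < δ) (hzt : z ≠ t) : z ∉ D := fun hzD =>
      hball hz ⟨hzD, hzt⟩
    rw [Real.dist_eq] at hs ⊢
    rcases le_total s t with hst | hst
    · have hd : Disjoint (Ioo s t) D := Set.disjoint_left.2 fun z hz => hcut z (by
        rw [Real.dist_eq, abs_lt] at *; constructor <;> linarith [hz.1, hz.2]) hz.2.ne
      have h1 := hDs s t hd
      rw [hFadd s t hst, abs_lt]
      constructor <;> linarith [hnn (seg s t)]
    · have hd : Disjoint (Ioo t s) D := Set.disjoint_left.2 fun z hz => hcut z (by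
        rw [Real.dist_eq, abs_lt] at *; constructor <;> linarith [hz.1, hz.2]) hz.1.ne'
      have h1 := hDs t s hd
      rw [hFadd t s hst, abs_lt]
      constructor <;> linarith [hnn (seg t s)]
  let f : StieltjesFunction ℝ := ⟨F, hmono, fun t => hcont.continuousWithinAt⟩
  have hIco (s t : ℝ) : f.measure (Ico s t) = ENNReal.ofReal (F t - F s) := by
    rw [StieltjesFunction.measure_Ico]
    have hl (t : ℝ) : Function.leftLim f t = F t :=
      hcont.continuousWithinAt.leftLim_eq
    rw [hl, hl]
  have emb : MeasurableEmbedding (Subtype.val : I → ℝ) :=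
    MeasurableEmbedding.subtype_coe measurableSet_Ico
  have himage (s t : ℝ) : (Subtype.val : I → ℝ) '' seg s t = Ico (max s 0) (min t 1) := by
    ext z
    simp only [mem_image, seg, mem_ofPred_eq, mem_Ico, max_le_iff, lt_min_iff]
    constructor
    · rintro ⟨y, ⟨h1, h2⟩, rfl⟩
      exact ⟨⟨h1, y.2.1⟩, h2, y.2.2⟩
    · rintro ⟨⟨h1, h2⟩, h3, h4⟩
      exact ⟨⟨z, h2, h4⟩, ⟨h1, h3⟩, rfl⟩
  have hseg (s t : ℝ) : (f.measure.comap (Subtype.val : I → ℝ)).real (seg s t) = c (seg s t) := by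
    rw [Measure.real, emb.comap_apply, himage, hIco]
    have heq : seg s t = seg (max s 0) (min t 1) := by
      rw [← emb.injective.image_injective.eq_iff, himage, himage]
      simp
    rcases le_total (max s 0) (min t 1) with h | h
    · rw [hFadd _ _ h, add_sub_cancel_left, ENNReal.toReal_ofReal (hnn _), ← heq]
    · have h1 : seg s t = ∅ := by
        rw [← image_eq_empty (f := (Subtype.val : I → ℝ)), himage, Ico_eq_empty_of_le h]
      rw [h1, hempty, ENNReal.ofReal_of_nonpos (by linarith [hmono h]), ENNReal.toReal_zero]
  refine ⟨_, ⟨?_⟩, hseg⟩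
  have huniv' : seg 0 1 = univ := by
    ext y
    simp [seg, y.2.1, y.2.2]
  have h1 := hseg 0 1
  rwa [huniv', huniv, Measure.real, ENNReal.toReal_eq_one_iff] at h1

/-- A measure that agrees on segments with an invariant finitely additive probability is
invariant, because preimages of segments are finite unions of segments. -/
theorem measurePreserving_of_content (hp : p ∈ paramRegion) (c : Set I → ℝ)
    (hadd : ∀ A B, MeasurableSet A → MeasurableSet B → Disjoint A B → c (A ∪ B) = c A + c B)
    (hinv : ∀ A, MeasurableSet A → c (extMap p (paramRegion_subset hp) ⁻¹' A) = c A)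
    {μ : Measure I} [IsProbabilityMeasure μ] (hμ : ∀ s t, μ.real (seg s t) = c (seg s t)) :
    MeasurePreserving (extMap p (paramRegion_subset hp)) μ μ := by
  have hT := measurable_extMap (paramRegion_subset hp)
  refine ⟨hT, ?_⟩
  have : IsProbabilityMeasure (μ.map (extMap p (paramRegion_subset hp))) :=
    Measure.isProbabilityMeasure_map hT.aemeasurable
  refine Measure.ext_of_Ici _ _ fun a => ?_
  have hA : Ici a = seg a 1 := by
    ext y
    simp [seg, y.2.2]
  rw [Measure.map_apply hT measurableSet_Ici, hA]
  have hpre : extMap p (paramRegion_subset hp) ⁻¹' (seg a 1) =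
      (seg (max 0 (a - p.1)) (1 - p.1) ∪ seg (max (1 - p.1) (a - p.2)) (1 - p.2)) ∪
        seg (max (1 - p.2) (a - p.2 + 1)) 1 := by
    obtain ⟨h1, h2, h3⟩ := hp
    ext x
    have hx0 := x.2.1
    have hx1 := x.2.2
    have hT1 := (extMap p (paramRegion_subset ⟨h1, h2, h3⟩) x).2.2
    rw [coe_extMap] at hT1
    simp only [mem_preimage, seg, mem_ofPred_eq, mem_union, max_le_iff, coe_extMap]
    rw [and_iff_left hT1, mapFormula]
    split_ifs with c1 c2
    · constructor
      · intro h
        exact Or.inl (Or.inl ⟨⟨hx0, by linarith⟩, c1⟩)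
      · rintro ((h | h) | h)
        · linarith [h.1.2]
        · linarith [h.1.1]
        · linarith [h.1.1]
    · constructor
      · intro h
        exact Or.inl (Or.inr ⟨⟨not_lt.1 c1, by linarith⟩, c2⟩)
      · rintro ((h | h) | h)
        · exact absurd h.2 c1
        · linarith [h.1.2]
        · linarith [h.1.1]
    · constructor
      · intro h
        exact Or.inr ⟨⟨not_lt.1 c2, by linarith⟩, hx1⟩
      · rintro ((h | h) | h)
        · exact absurd h.2 c1
        · exact absurd h.2 c2
        · linarith [h.1.2]
  have hd1 : Disjoint (seg (max 0 (a - p.1)) (1 - p.1))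
      (seg (max (1 - p.1) (a - p.2)) (1 - p.2)) := Set.disjoint_left.2 fun y h1 h2 =>
    absurd ((le_max_left _ _).trans h2.1) (not_le.2 h1.2)
  have hd2 : Disjoint (seg (max 0 (a - p.1)) (1 - p.1) ∪
      seg (max (1 - p.1) (a - p.2)) (1 - p.2)) (seg (max (1 - p.2) (a - p.2 + 1)) 1) := by
    refine Set.disjoint_left.2 fun y h1 h2 => ?_
    have h3 := (le_max_left _ _).trans h2.1
    have h4 := hp.2.1
    rcases h1 with h1 | h1
    · linarith [h1.2]
    · linarith [h1.2]
  have hreal : μ.real (extMap p (paramRegion_subset hp) ⁻¹' (seg a 1)) = μ.real (seg a 1) := by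
    rw [hμ, ← hinv _ (measurableSet_seg _ _), hpre,
      hadd _ _ ((measurableSet_seg _ _).union (measurableSet_seg _ _)) (measurableSet_seg _ _) hd2,
      hadd _ _ (measurableSet_seg _ _) (measurableSet_seg _ _) hd1,
      measureReal_union hd2 (measurableSet_seg _ _), measureReal_union hd1 (measurableSet_seg _ _),
      hμ, hμ, hμ]
  rwa [Measure.real, Measure.real,
    ENNReal.toReal_eq_toReal_iff' (measure_ne_top _ _) (measure_ne_top _ _)] at hreal

/-- Every point of the limit set is the frequency vector of an invariant probability measure. -/
theorem IsRenormalizable.exists_measurePreserving (h : IsRenormalizable p) {q : ℝ × ℝ}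
    (hq : q ∈ limitSet p) : ∃ μ : Measure I, IsProbabilityMeasure μ ∧
      MeasurePreserving (extMap p (paramRegion_subset h.mem)) μ μ ∧ freqVector p μ = q := by
  obtain ⟨q, rfl, hqo⟩ := h.exists_isFreqOrbit hq
  choose μ hprob m1 m2 m3 hdef hbase using fun n => hqo.exists_approx n h
  have hlim (A : Set I) : ∃ x : ℝ, Tendsto (fun n => (μ n).real A) (hyperfilter ℕ) (𝓝 x) := by
    have hK : IsCompact (Icc (0 : ℝ) 1) := isCompact_Icc
    obtain ⟨x, -, hx⟩ := hK.ultrafilter_le_nhds ((hyperfilter ℕ).map fun n => (μ n).real A) (by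
      rw [Ultrafilter.coe_map, le_principal_iff, mem_map]
      exact univ_mem' fun n => ⟨measureReal_nonneg, measureReal_le_one⟩)
    exact ⟨x, hx⟩
  choose c hc using hlim
  have hle : (hyperfilter ℕ : Filter ℕ) ≤ atTop := by
    rw [← Nat.cofinite_eq_atTop]
    exact hyperfilter_le_cofinite
  have hadd (A B : Set I) (_ : MeasurableSet A) (hB : MeasurableSet B) (hAB : Disjoint A B) :
      c (A ∪ B) = c A + c B :=
    tendsto_nhds_unique (hc _) (((hc A).add (hc B)).congr fun n =>
      (measureReal_union hAB hB).symm)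
  have hnn (A : Set I) : 0 ≤ c A := ge_of_tendsto' (hc A) fun n => measureReal_nonneg
  have hmono {A B : Set I} (hAB : A ⊆ B) : c A ≤ c B :=
    le_of_tendsto_of_tendsto' (hc A) (hc B) fun n => measureReal_mono hAB
  have huniv : c univ = 1 := tendsto_nhds_unique (hc _)
    (tendsto_const_nhds.congr fun n => (probReal_univ (μ := μ n)).symm)
  have hinv (A : Set I) (hA : MeasurableSet A) :
      c (extMap p (paramRegion_subset h.mem) ⁻¹' A) = c A := by
    refine sub_eq_zero.1 (tendsto_nhds_unique ((hc _).sub (hc A)) ?_)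
    exact squeeze_zero_norm (fun n => hdef n A hA) ((hqo.tendsto_baseMass h).mono_left hle)
  have hinvi (j : ℕ) (A : Set I) (hA : MeasurableSet A) :
      c ((extMap p (paramRegion_subset h.mem))^[j] ⁻¹' A) = c A := by
    induction j with
    | zero => rfl
    | succ j ih =>
      rw [Function.iterate_succ, preimage_comp,
        hinv _ (((measurable_extMap _).iterate j) hA), ih]
  have hbase' (m : ℕ) : c (seg (1 - returnLength p m) 1) ≤ baseMass q m :=
    le_of_tendsto (hc _) (hle ((eventually_ge_atTop m).mono fun n hn => hbase n m hn))
  obtain ⟨ν, hν, hνc⟩ := exists_measure_of_content c hadd hnn huniv (by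
    intro ε hε
    obtain ⟨m, hm⟩ := ((hqo.tendsto_baseMass h).eventually_lt_const hε).exists
    obtain ⟨N, hN⟩ := IsRenormalizable.exists_iterate_ge m h
    obtain ⟨D, hD, hDx⟩ := exists_finite_cuts h.mem (1 - returnLength p m) N
    refine ⟨D, hD, fun s t hst => ?_⟩
    rcases (seg s t).eq_empty_or_nonempty with he | ⟨y, hy⟩
    · rw [he]
      refine (hmono (empty_subset _)).trans ((hbase' m).trans hm.le)
    · have hx1 : max s 0 < 1 := max_lt (hy.1.trans_lt y.2.2) one_pos
      set x : I := ⟨max s 0, le_max_right _ _, hx1⟩ with hx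
      have hseg : seg s t ⊆ seg x t := fun z hz => ⟨max_le hz.1 z.2.1, hz.2⟩
      obtain ⟨j, -, hj⟩ := hDx x t
        (hst.mono_left (Ioo_subset_Ioo_left (le_max_left s 0))) (hN x)
      calc c (seg s t) ≤ c ((extMap p (paramRegion_subset h.mem))^[j] ⁻¹'
            seg (1 - returnLength p m) 1) :=
            hmono fun z hz => ⟨hj z (hseg hz),
              ((extMap p (paramRegion_subset h.mem))^[j] z).2.2⟩
        _ ≤ ε := by
            rw [hinvi _ _ (measurableSet_seg _ _)]
            exact (hbase' m).trans hm.le)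
  refine ⟨ν, hν, measurePreserving_of_content h.mem c hadd hinv hνc, ?_⟩
  have b1 : ν.real (branch₁ p) = 1 - (q 0).2 := by
    rw [branch₁_eq_seg, hνc, ← branch₁_eq_seg]
    exact tendsto_nhds_unique (hc _) (tendsto_const_nhds.congr fun n => (m1 n).symm)
  have b2 : ν.real (branch₂ p) = (q 0).1 + (q 0).2 - 1 := by
    rw [branch₂_eq_seg, hνc, ← branch₂_eq_seg]
    exact tendsto_nhds_unique (hc _) (tendsto_const_nhds.congr fun n => (m2 n).symm)
  have b3 : ν.real (branch₃ p) = 1 - (q 0).1 := by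
    rw [branch₃_eq_seg, hνc, ← branch₃_eq_seg]
    exact tendsto_nhds_unique (hc _) (tendsto_const_nhds.congr fun n => (m3 n).symm)
  rw [freqVector, b1, b2, b3]
  ext <;> simp

/-! ### Ergodic measures and extreme points -/

theorem freqVector_add_smul (p : ℝ × ℝ) {a b : ℝ≥0∞} (ha : a ≠ ∞) (hb : b ≠ ∞) (μ ν : Measure I)
    [IsFiniteMeasure μ] [IsFiniteMeasure ν] :
    freqVector p (a • μ + b • ν) = a.toReal • freqVector p μ + b.toReal • freqVector p ν := by
  have := Measure.smul_finite μ ha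
  have := Measure.smul_finite ν hb
  have hr (A : Set I) : (a • μ + b • ν).real A = a.toReal * μ.real A + b.toReal * ν.real A := by
    rw [measureReal_add_apply, measureReal_ennreal_smul_apply, measureReal_ennreal_smul_apply]
  simp only [freqVector, hr]
  ext <;> simp <;> ring

theorem real_branch_of_isProbabilityMeasure (hp : p ∈ extRegion) (μ : Measure I)
    [IsProbabilityMeasure μ] : μ.real (branch₁ p) = 1 - (freqVector p μ).2 ∧
      μ.real (branch₂ p) = (freqVector p μ).1 + (freqVector p μ).2 - 1 ∧
      μ.real (branch₃ p) = 1 - (freqVector p μ).1 := by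
  have h := measureReal_univ_eq_add_branch hp μ
  rw [probReal_univ] at h
  simp only [freqVector]
  refine ⟨?_, ?_, ?_⟩ <;> linarith

theorem freqVector_mem_freqTriangle (hp : p ∈ extRegion) (μ : Measure I)
    [IsProbabilityMeasure μ] : freqVector p μ ∈ freqTriangle := by
  obtain ⟨h1, h2, h3⟩ := real_branch_of_isProbabilityMeasure hp μ
  have b1 : 0 ≤ μ.real (branch₁ p) := measureReal_nonneg
  have b2 : 0 ≤ μ.real (branch₂ p) := measureReal_nonneg
  have b3 : 0 ≤ μ.real (branch₃ p) := measureReal_nonneg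
  refine ⟨?_, ?_, ?_⟩ <;> linarith

theorem lift_zero (hp : p ∈ paramRegion) : lift p hp 0 = 0 := by
  have h := towerMeasure_smul (T := extMap p (paramRegion_subset hp)) (φ := returnEmb p hp)
    (r := returnTime p) 0 0
  rwa [zero_smul, zero_smul] at h

/-- The conditional measure on the return interval, in the rescaled coordinate. -/
theorem exists_comap_eq_smul (hp : p ∈ paramRegion) {μ : Measure I} [IsProbabilityMeasure μ]
    (hμ : MeasurePreserving (extMap p (paramRegion_subset hp)) μ μ) :
    ∃ (s : ℝ≥0∞) (e : Measure I), s ≠ 0 ∧ s ≠ ∞ ∧ IsProbabilityMeasure e ∧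
      MeasurePreserving (extMap (gauss p) (gauss_mem_extRegion hp)) e e ∧
      μ = s • lift p hp e := by
  set d := μ.comap (returnEmb p hp) with hd
  have hkac := eq_lift_comap hp hμ
  have hfin : IsFiniteMeasure d := by
    refine ⟨?_⟩
    rw [hd, (measurableEmbedding_returnEmb hp).comap_apply]
    exact measure_lt_top _ _
  have hne : d ≠ 0 := fun h0 => by
    rw [← hd, h0, lift_zero] at hkac
    exact IsProbabilityMeasure.ne_zero μ hkac
  have hs0 : d univ ≠ 0 := fun h0 => hne (Measure.measure_univ_eq_zero.1 h0)
  have hst : d univ ≠ ∞ := measure_ne_top _ _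
  have hinv := measurePreserving_comap_returnEmb hp hμ
  refine ⟨d univ, (d univ)⁻¹ • d, hs0, hst, ⟨?_⟩, hinv.smul_measure _, ?_⟩
  · rw [Measure.smul_apply, smul_eq_mul, ENNReal.inv_mul_cancel hs0 hst]
  · rw [lift, towerMeasure_smul, smul_smul, ENNReal.mul_inv_cancel hs0 hst, one_smul]
    exact hkac

theorem freqVector_mem_image_freqComp (n : ℕ) : ∀ {p : ℝ × ℝ} (hp : IsRenormalizable p)
    {μ : Measure I} [IsProbabilityMeasure μ]
    (_ : MeasurePreserving (extMap p (paramRegion_subset hp.mem)) μ μ),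
    freqVector p μ ∈ freqComp (code p) n '' freqTriangle := by
  induction n with
  | zero =>
    intro p hp μ _ _
    exact ⟨_, freqVector_mem_freqTriangle (paramRegion_subset hp.mem) μ, rfl⟩
  | succ n ih =>
    intro p hp μ _ hμ
    obtain ⟨s, e, hs0, hst, he, hinv, hμe⟩ := exists_comap_eq_smul hp.mem hμ
    rw [freqComp_succ', image_comp]
    refine ⟨freqVector (gauss p) e, ih hp.renorm hinv, ?_⟩
    have := isFiniteMeasure_lift hp.mem e
    have hr (A : Set I) : μ.real A = s.toReal * (lift p hp.mem e).real A := by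
      rw [hμe, measureReal_ennreal_smul_apply]
    have e1 := lift_real_branch₁ hp.mem e
    have e2 := lift_real_branch₂ hp.mem e
    have e3 := lift_real_branch₃ hp.mem e
    have h := measureReal_univ_eq_add_branch (paramRegion_subset hp.mem) μ
    have h' := measureReal_univ_eq_add_branch (gauss_mem_extRegion hp.mem) e
    rw [probReal_univ] at h'
    rw [probReal_univ, hr, hr, hr, e1, e2, e3] at h
    have hspos : 0 < s.toReal := ENNReal.toReal_pos hs0 hst
    set x := e.real (branch₁ (gauss p))
    set y := e.real (branch₂ (gauss p))
    set z := e.real (branch₃ (gauss p))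
    have hN : (⌊1 / p.1⌋₊ : ℝ) * (y + z) + (x + y) = 1 / s.toReal := by
      rw [eq_div_iff hspos.ne']
      linear_combination -h
    simp only [freqMap, freqVector, code_zero]
    rw [hr, hr, hr, e1, e2, e3, hN]
    refine Prod.ext ?_ ?_
    · change 1 - (y + z) / (1 / s.toReal) = _
      rw [div_div_eq_mul_div, div_one]
      linear_combination h
    · change 1 / (1 / s.toReal) = _
      rw [one_div_one_div]
      linear_combination s.toReal * h'

theorem IsRenormalizable.freqVector_mem_limitSet (h : IsRenormalizable p) {μ : Measure I}
    [IsProbabilityMeasure μ]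
    (hμ : MeasurePreserving (extMap p (paramRegion_subset h.mem)) μ μ) :
    freqVector p μ ∈ limitSet p :=
  mem_iInter.2 fun i => freqVector_mem_image_freqComp (i + 1) h hμ

theorem IsRenormalizable.eq_of_freqVector_eq (h : IsRenormalizable p) {μ ν : Measure I}
    [IsProbabilityMeasure μ] [IsProbabilityMeasure ν]
    (hμ : MeasurePreserving (extMap p (paramRegion_subset h.mem)) μ μ)
    (hν : MeasurePreserving (extMap p (paramRegion_subset h.mem)) ν ν)
    (hμν : freqVector p μ = freqVector p ν) : μ = ν := by
  obtain ⟨a1, a2, a3⟩ := real_branch_of_isProbabilityMeasure (paramRegion_subset h.mem) μ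
  obtain ⟨b1, b2, b3⟩ := real_branch_of_isProbabilityMeasure (paramRegion_subset h.mem) ν
  exact h.eq_of_real_branch_eq hμ hν (by rw [a1, b1, hμν]) (by rw [a2, b2, hμν])
    (by rw [a3, b3, hμν])

/-- For an infinitely renormalizable map, `freqVector` is an affine bijection from the invariant
probability measures onto the limit set, so it matches the extreme points of both sets; those of
the first set are the ergodic measures. -/
theorem IsRenormalizable.bijOn_freqVector (h : IsRenormalizable p) :
    BijOn (freqVector p) (ergodicMeasures (itm p h.mem)) (extremePoints ℝ (limitSet p)) := by
  rw [itm_eq_extMap]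
  refine ⟨?_, ?_, ?_⟩
  · rintro μ ⟨hprob, herg⟩
    rw [mem_extremePoints_iff_left]
    refine ⟨h.freqVector_mem_limitSet herg.toMeasurePreserving, ?_⟩
    rintro q₁ hq₁ q₂ hq₂ ⟨a, b, ha, hb, hab, hq⟩
    obtain ⟨μ₁, hp₁, hi₁, rfl⟩ := h.exists_measurePreserving hq₁
    obtain ⟨μ₂, hp₂, hi₂, rfl⟩ := h.exists_measurePreserving hq₂
    have hab' : ENNReal.ofReal a + ENNReal.ofReal b = 1 := by
      rw [← ENNReal.ofReal_add ha.le hb.le, hab, ENNReal.ofReal_one]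
    have hprob' : IsProbabilityMeasure (ENNReal.ofReal a • μ₁ + ENNReal.ofReal b • μ₂) :=
      ⟨by simpa using hab'⟩
    have heq : ENNReal.ofReal a • μ₁ + ENNReal.ofReal b • μ₂ = μ := by
      refine h.eq_of_freqVector_eq ((hi₁.smul_measure _).add_measure (hi₂.smul_measure _))
        herg.toMeasurePreserving ?_
      rw [freqVector_add_smul p ENNReal.ofReal_ne_top ENNReal.ofReal_ne_top,
        ENNReal.toReal_ofReal ha.le, ENNReal.toReal_ofReal hb.le, hq]
    have hext := (mem_extremePoints_iff_left.1 herg.mem_extremePoints).2 μ₁ ⟨hi₁, hp₁⟩ μ₂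
      ⟨hi₂, hp₂⟩ ⟨_, _, ENNReal.ofReal_pos.2 ha, ENNReal.ofReal_pos.2 hb, hab', heq⟩
    rw [hext]
  · rintro μ ⟨_, hμ⟩ ν ⟨_, hν⟩ hμν
    exact h.eq_of_freqVector_eq hμ.toMeasurePreserving hν.toMeasurePreserving hμν
  · intro q hq
    obtain ⟨hqmem, hqext⟩ := mem_extremePoints_iff_left.1 hq
    obtain ⟨μ, hprob, hinv, rfl⟩ := h.exists_measurePreserving hqmem
    refine ⟨μ, ⟨hprob, Ergodic.of_mem_extremePoints ?_⟩, rfl⟩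
    rw [mem_extremePoints_iff_left]
    refine ⟨⟨hinv, hprob⟩, ?_⟩
    rintro μ₁ ⟨hi₁, hp₁⟩ μ₂ ⟨hi₂, hp₂⟩ ⟨a, b, ha, hb, hab, rfl⟩
    have ha' : a ≠ ∞ := ne_top_of_le_ne_top ENNReal.one_ne_top (hab ▸ le_self_add)
    have hb' : b ≠ ∞ := ne_top_of_le_ne_top ENNReal.one_ne_top (hab ▸ le_add_self)
    refine h.eq_of_freqVector_eq hi₁ hinv ?_
    refine hqext _ (h.freqVector_mem_limitSet hi₁) _ (h.freqVector_mem_limitSet hi₂)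
      ⟨a.toReal, b.toReal, ENNReal.toReal_pos ha.ne' ha', ENNReal.toReal_pos hb.ne' hb', ?_,
        (freqVector_add_smul p ha' hb' μ₁ μ₂).symm⟩
    rw [← ENNReal.toReal_add ha' hb', hab, ENNReal.toReal_one]

/-! ### Maps that are not infinitely renormalizable: finite type -/

theorem omega_eq_range (T : I → I) (n : ℕ) : omega T n = range T^[n] := by
  induction n with
  | zero => simp [omega]
  | succ n ih => rw [omega, ih, Function.iterate_succ', range_comp]

/-- `X` is an attractor reached in bounded time: it is mapped onto itself and contains some iterated
image of the whole space. -/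
def IsAttractor (T : I → I) (X : Set I) : Prop := T '' X = X ∧ ∃ n, ∀ x, T^[n] x ∈ X

theorem IsAttractor.isFiniteType {T : I → I} {X : Set I} (h : IsAttractor T X) :
    IsFiniteType T := by
  obtain ⟨hX, n, hn⟩ := h
  have himage (m : ℕ) : T^[m] '' X = X := by
    induction m with
    | zero => simp
    | succ m ih => rw [Function.iterate_succ, image_comp, hX, ih]
  have homega : omega T n = X := by
    rw [omega_eq_range]
    refine Subset.antisymm (range_subset_iff.2 hn) ?_
    rw [← himage n]
    exact image_subset_range _ _
  exact ⟨n, by rw [omega, homega, hX]⟩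

theorem exists_isAttractor_of_gauss (hp : p ∈ paramRegion)
    (h : ∃ X, IsAttractor (extMap (gauss p) (gauss_mem_extRegion hp)) X) :
    ∃ X, IsAttractor (extMap p (paramRegion_subset hp)) X := by
  obtain ⟨X', hX', n, hn⟩ := h
  set T := extMap p (paramRegion_subset hp) with hT
  set T' := extMap (gauss p) (gauss_mem_extRegion hp) with hT'
  set X : Set I := {x | ∃ j : ℕ, ∃ u ∈ X', T^[j] (returnEmb p hp u) = x} with hX
  have hmaps (x : I) (hx : x ∈ X) : T x ∈ X := by
    obtain ⟨j, u, hu, rfl⟩ := hx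
    exact ⟨j + 1, u, hu, Function.iterate_succ_apply' _ _ _⟩
  have hmapsi (i : ℕ) (x : I) (hx : x ∈ X) : T^[i] x ∈ X := by
    induction i with
    | zero => exact hx
    | succ i ih => rw [Function.iterate_succ_apply']; exact hmaps _ ih
  refine ⟨X, Subset.antisymm (image_subset_iff.2 hmaps) ?_, ?_⟩
  · rintro x ⟨j, u, hu, rfl⟩
    rcases j with _ | j
    · rw [← hX'] at hu
      obtain ⟨v, hv, rfl⟩ := hu
      rw [Function.iterate_zero_apply, returnEmb_extMap_gauss hp]
      have hr := returnTime_pos hp v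
      obtain ⟨m, hm⟩ : ∃ m, returnTime p v = m + 1 := ⟨returnTime p v - 1, by omega⟩
      rw [hm, Function.iterate_succ_apply']
      exact mem_image_of_mem _ ⟨m, v, hv, rfl⟩
    · rw [Function.iterate_succ_apply']
      exact mem_image_of_mem _ ⟨j, u, hu, rfl⟩
  · refine ⟨n * (⌊1 / p.1⌋₊ + 1) + ⌊1 / p.1⌋₊, fun x => ?_⟩
    obtain ⟨i, hi, u, hu⟩ := exists_iterate_mem_range_returnEmb hp x
    obtain ⟨t, -, ht, htu⟩ := exists_iterate_returnEmb hp u n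
    have hmem : T^[t + i] x ∈ X := by
      rw [Function.iterate_add_apply, ← hu, ← htu]
      exact ⟨0, _, hn u, rfl⟩
    have hle := add_le_add ht hi
    rw [← Nat.sub_add_cancel hle, Function.iterate_add_apply]
    exact hmapsi _ _ hmem

/-- Outside `paramRegion` the map is a translation by `α` modulo some `L`; its attractor is the
segment `[1 - L, 1)`. -/
theorem exists_translation_modulus (hp : p ∈ extRegion) (hp' : p ∉ paramRegion) :
    ∃ L, p.1 ≤ L ∧ L ≤ 1 ∧ ∀ x : I, (extMap p hp x : ℝ) =
      if (x : ℝ) < 1 - p.1 then (x : ℝ) + p.1 else (x : ℝ) + p.1 - L := by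
  obtain ⟨h1, h2, h3, h4⟩ := id hp
  rcases h4.eq_or_lt with h5 | h5
  · refine ⟨1, h2.le, le_rfl, fun x => ?_⟩
    rw [coe_extMap, mapFormula, h5]
    split_ifs <;> rfl
  · have h6 : p.2 ≤ 0 := by
      by_contra! h6
      exact hp' ⟨h6, h5, h2⟩
    refine ⟨p.1 - p.2, by linarith, by linarith, fun x => ?_⟩
    have hx := x.2.2
    rw [coe_extMap, mapFormula]
    split_ifs
    · rfl
    · ring
    · linarith

theorem isAttractor_of_translation (hp : p ∈ extRegion) {L : ℝ} (hL : p.1 ≤ L) (hL1 : L ≤ 1)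
    (hT : ∀ x : I, (extMap p hp x : ℝ) =
      if (x : ℝ) < 1 - p.1 then (x : ℝ) + p.1 else (x : ℝ) + p.1 - L) :
    IsAttractor (extMap p hp) {x | 1 - L ≤ (x : ℝ)} := by
  have hpos := hp.1
  have hlt := hp.2.1
  have hmaps (x : I) (hx : 1 - L ≤ (x : ℝ)) : 1 - L ≤ (extMap p hp x : ℝ) := by
    rw [hT]
    split_ifs <;> linarith
  refine ⟨Subset.antisymm (image_subset_iff.2 hmaps) fun y hy => ?_, ?_⟩
  · have hy' : 1 - L ≤ (y : ℝ) := hy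
    have hy1 := y.2.2
    rcases lt_or_ge (y : ℝ) (1 - L + p.1) with h | h
    · refine ⟨⟨y - p.1 + L, by linarith, by linarith⟩, ?_, Subtype.ext ?_⟩
      · change 1 - L ≤ (y : ℝ) - p.1 + L
        linarith
      · rw [hT, if_neg]
        · change (y : ℝ) - p.1 + L + p.1 - L = y
          ring
        · change ¬ ((y : ℝ) - p.1 + L < 1 - p.1)
          linarith
    · refine ⟨⟨y - p.1, by linarith, by linarith⟩, ?_, Subtype.ext ?_⟩
      · change 1 - L ≤ (y : ℝ) - p.1
        linarith
      · rw [hT, if_pos]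
        · change (y : ℝ) - p.1 + p.1 = y
          ring
        · change (y : ℝ) - p.1 < 1 - p.1
          linarith
  · obtain ⟨n, hn⟩ := exists_nat_ge (1 / p.1)
    rw [div_le_iff₀ hpos] at hn
    have key (x : I) (m : ℕ) : 1 - L ≤ ((extMap p hp)^[m] x : ℝ) ∨
        (x : ℝ) + m * p.1 ≤ ((extMap p hp)^[m] x : ℝ) := by
      induction m with
      | zero => right; simp
      | succ m ih =>
        rw [Function.iterate_succ_apply']
        rcases ih with ih | ih
        · exact Or.inl (hmaps _ ih)
        · rcases le_or_gt (1 - L) ((extMap p hp)^[m] x : ℝ) with h | h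
          · exact Or.inl (hmaps _ h)
          · right
            rw [hT, if_pos (by linarith)]
            push_cast
            linarith
    refine ⟨n, fun x => ?_⟩
    rcases key x n with h | h
    · exact h
    · have := x.2.1
      change 1 - L ≤ ((extMap p hp)^[n] x : ℝ)
      linarith

/-- Induction along the renormalizations that lead out of `paramRegion`. -/
theorem induction_of_not_isRenormalizable {P : ∀ p, p ∈ extRegion → Prop}
    (hbase : ∀ p (hp : p ∈ extRegion), p ∉ paramRegion → P p hp)
    (hstep : ∀ p (hp : p ∈ paramRegion), P (gauss p) (gauss_mem_extRegion hp) →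
      P p (paramRegion_subset hp))
    (hp : p ∈ extRegion) (h : ¬ IsRenormalizable p) : P p hp := by
  obtain ⟨n, hn⟩ := not_forall.1 h
  clear h
  induction n generalizing p with
  | zero => exact hbase p hp hn
  | succ n ih =>
    by_cases hp' : p ∈ paramRegion
    · exact hstep p hp' (ih (gauss_mem_extRegion hp') hn)
    · exact hbase p hp hp'

theorem isFiniteType_of_not_isRenormalizable (hp : p ∈ extRegion) (h : ¬ IsRenormalizable p) :
    IsFiniteType (extMap p hp) := by
  have hattr : ∃ X, IsAttractor (extMap p hp) X := by
    refine induction_of_not_isRenormalizable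
      (P := fun p hp => ∃ X, IsAttractor (extMap p hp) X) ?_ ?_ hp h
    · intro p hp hp'
      obtain ⟨L, h1, h2, h3⟩ := exists_translation_modulus hp hp'
      exact ⟨_, isAttractor_of_translation hp h1 h2 h3⟩
    · exact fun p hp => exists_isAttractor_of_gauss hp
  obtain ⟨X, hX⟩ := hattr
  exact hX.isFiniteType

/-! ### Maps that are not infinitely renormalizable: unique ergodicity -/

/-- There is at most one invariant probability measure. -/
def AtMostOneInvariant (T : I → I) : Prop :=
  ∀ μ ν : Measure I, IsProbabilityMeasure μ → IsProbabilityMeasure ν →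
    MeasurePreserving T μ μ → MeasurePreserving T ν ν → μ = ν

theorem atMostOneInvariant_of_gauss (hp : p ∈ paramRegion)
    (h : AtMostOneInvariant (extMap (gauss p) (gauss_mem_extRegion hp))) :
    AtMostOneInvariant (extMap p (paramRegion_subset hp)) := by
  intro μ ν hμ hν hμi hνi
  obtain ⟨s, e, -, -, he, hei, hse⟩ := exists_comap_eq_smul hp hμi
  obtain ⟨t, e', -, -, he', hei', hte⟩ := exists_comap_eq_smul hp hνi
  obtain rfl := h e e' he he' hei hei'
  have h1 : s * lift p hp e univ = 1 := by
    rw [← smul_eq_mul, ← Measure.smul_apply, ← hse, measure_univ]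
  have h2 : t * lift p hp e univ = 1 := by
    rw [← smul_eq_mul, ← Measure.smul_apply, ← hte, measure_univ]
  rw [hse, hte, ENNReal.eq_inv_of_mul_eq_one_left h1, ENNReal.eq_inv_of_mul_eq_one_left h2]

theorem isAperiodic_gauss (hp : p ∈ paramRegion)
    (h : IsAperiodic (extMap p (paramRegion_subset hp))) :
    IsAperiodic (extMap (gauss p) (gauss_mem_extRegion hp)) := by
  refine eq_empty_of_forall_notMem fun u hu => ?_
  obtain ⟨n, hn, hu⟩ := hu
  obtain ⟨t, ht, -, htu⟩ := exists_iterate_returnEmb hp u n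
  rw [hu.eq] at htu
  exact notMem_empty (returnEmb p hp u) (h ▸ ⟨t, by omega, htu.symm⟩)

/-- A finite measure on the circle that is invariant under a translation with dense orbits is
invariant under all translations. -/
theorem isAddLeftInvariant_of_denseRange {L : ℝ} [Fact (0 < L)] {a : AddCircle L}
    (ha : DenseRange (· • a : ℤ → AddCircle L)) {m : Measure (AddCircle L)} [IsFiniteMeasure m]
    (hm : MeasurePreserving (a + ·) m m) : m.IsAddLeftInvariant := by
  have hzsmul (z : ℤ) : MeasurePreserving (z • a + ·) m m := by
    have hneg : MeasurePreserving (-a + ·) m m := by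
      have := MeasurePreserving.symm (MeasurableEquiv.addLeft a) hm
      rwa [MeasurableEquiv.symm_addLeft] at this
    induction z with
    | zero => simpa using! MeasurePreserving.id m
    | succ n ih =>
      have := ih.comp hm
      convert this using 2 with x
      rw [add_zsmul, one_zsmul, add_assoc]
      rfl
    | pred n ih =>
      have := ih.comp hneg
      convert this using 2 with x
      rw [sub_eq_add_neg, add_zsmul, neg_one_zsmul, add_assoc]
      rfl
  refine ⟨fun g => ?_⟩
  refine ext_of_forall_integral_eq_of_IsFiniteMeasure fun f => ?_
  rw [integral_map (by fun_prop) f.continuous.aestronglyMeasurable]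
  have hcont : Continuous fun g => ∫ x, f (g + x) ∂m := by
    refine continuous_of_dominated (bound := fun _ => ‖f‖) (fun g => ?_) (fun g => ?_)
      (integrable_const _) (ae_of_all _ fun x => by fun_prop)
    · exact (f.continuous.comp (continuous_const.add continuous_id)).aestronglyMeasurable
    · exact ae_of_all _ fun x => f.norm_coe_le_norm _
  have heq := ha.equalizer (g := fun g => ∫ x, f (g + x) ∂m) (h := fun _ => ∫ x, f x ∂m) hcont
    continuous_const (by
    ext z
    have hz := hzsmul z
    have h1 := integral_map (μ := m) (φ := (z • a + ·)) (by fun_prop)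
      (f := f) f.continuous.aestronglyMeasurable
    rw [hz.map_eq] at h1
    exact h1.symm)
  exact congrFun heq g

/-- Outside `paramRegion` an aperiodic map is, on its attractor, conjugate to an irrational
rotation of a circle. -/
theorem atMostOneInvariant_of_translation (hp : p ∈ extRegion) {L : ℝ} (hL : p.1 ≤ L)
    (hL1 : L ≤ 1) (hT : ∀ x : I, (extMap p hp x : ℝ) =
      if (x : ℝ) < 1 - p.1 then (x : ℝ) + p.1 else (x : ℝ) + p.1 - L)
    (haper : IsAperiodic (extMap p hp)) : AtMostOneInvariant (extMap p hp) := by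
  have hattr := isAttractor_of_translation hp hL hL1 hT
  set X : Set I := {x | 1 - L ≤ (x : ℝ)} with hX
  have hLpos : 0 < L := hp.1.trans_le hL
  have : Fact (0 < L) := ⟨hLpos⟩
  set π : I → AddCircle L := fun x => ((x : ℝ) : AddCircle L) with hπ
  have hπm : Measurable π := AddCircle.measurable_mk'.comp measurable_subtype_coe
  have hsemi (x : I) : π (extMap p hp x) = ((p.1 : ℝ) : AddCircle L) + π x := by
    simp only [hπ, hT]
    split_ifs
    · rw [AddCircle.coe_add, add_comm]
    · rw [AddCircle.coe_sub, AddCircle.coe_add, AddCircle.coe_period, sub_zero, add_comm]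
  have hsemii (n : ℕ) (x : I) :
      π ((extMap p hp)^[n] x) = n • ((p.1 : ℝ) : AddCircle L) + π x := by
    induction n with
    | zero => simp
    | succ n ih => rw [Function.iterate_succ_apply', hsemi, ih, succ_nsmul', add_assoc]
  -- The inverse of `π` on the attractor.
  have hmemI (z : Ico (1 - L) (1 - L + L)) : (z : ℝ) ∈ Ico (0 : ℝ) 1 :=
    ⟨by linarith [z.2.1], by linarith [z.2.2]⟩
  let σ : AddCircle L → I := fun y =>
    ⟨AddCircle.measurableEquivIco L (1 - L) y, hmemI _⟩
  have hσm : Measurable σ :=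
    (measurable_subtype_coe.comp (AddCircle.measurableEquivIco L (1 - L)).measurable).subtype_mk
  have hσπ (x : I) (hx : x ∈ X) : σ (π x) = x := by
    apply Subtype.ext
    change ((AddCircle.equivIco L (1 - L) ((x : ℝ) : AddCircle L)) : ℝ) = x
    rw [AddCircle.equivIco_coe_eq (x := (x : ℝ)) ⟨hx, by linarith [x.2.2]⟩]
  have hmapsi (n : ℕ) (x : I) (hx : x ∈ X) : (extMap p hp)^[n] x ∈ X := by
    induction n with
    | zero => exact hx
    | succ n ih =>
      rw [Function.iterate_succ_apply', ← hattr.1]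
      exact mem_image_of_mem _ ih
  have horder : addOrderOf ((p.1 : ℝ) : AddCircle L) = 0 := by
    by_contra hne
    set n := addOrderOf ((p.1 : ℝ) : AddCircle L) with hn
    let x : I := ⟨1 - L, by linarith, by linarith⟩
    have hx : x ∈ X := le_refl (1 - L)
    have hper : (extMap p hp)^[n] x = x := by
      rw [← hσπ _ (hmapsi n x hx), hsemii, hn, addOrderOf_nsmul_eq_zero, zero_add, hσπ x hx]
    exact notMem_empty x (haper ▸ ⟨n, Nat.pos_of_ne_zero hne, hper⟩)
  have hdense := AddCircle.denseRange_zsmul_iff.2 horder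
  have hpush (μ : Measure I) (_ : IsProbabilityMeasure μ)
      (hμ : MeasurePreserving (extMap p hp) μ μ) :
      μ = (AddCircle.haarAddCircle (T := L)).map σ := by
    have hprob : IsProbabilityMeasure (μ.map π) := Measure.isProbabilityMeasure_map hπm.aemeasurable
    have hinv : MeasurePreserving (((p.1 : ℝ) : AddCircle L) + ·) (μ.map π) (μ.map π) := by
      refine ⟨by fun_prop, ?_⟩
      rw [Measure.map_map (by fun_prop) hπm]
      conv_rhs => rw [← hμ.map_eq, Measure.map_map hπm hμ.measurable]
      congr 1
      ext x
      exact (hsemi x).symm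
    have := isAddLeftInvariant_of_denseRange hdense hinv
    have hhaar : (μ.map π).IsAddHaarMeasure :=
      Measure.isAddHaarMeasure_of_isCompact_nonempty_interior _ univ isCompact_univ
        (by simp) (by simp) (by simp)
    rw [← Measure.isAddHaarMeasure_eq_of_isProbabilityMeasure (μ.map π) AddCircle.haarAddCircle,
      Measure.map_map hσm hπm]
    have hae : σ ∘ π =ᵐ[μ] id := by
      obtain ⟨n, hn⟩ := hattr.2
      have hXm : MeasurableSet X := measurable_subtype_coe measurableSet_Ici
      have hnull : μ Xᶜ = 0 := by
        rw [← (hμ.iterate n).measure_preimage hXm.compl.nullMeasurableSet]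
        convert measure_empty (μ := μ)
        exact eq_empty_of_forall_notMem fun x hx => hx (hn x)
      have : ∀ᵐ x ∂μ, x ∈ X := hnull
      filter_upwards [this] with x hx using hσπ x hx
    rw [Measure.map_congr hae, Measure.map_id]
  intro μ ν hμ hν hμi hνi
  rw [hpush μ hμ hμi, hpush ν hν hνi]

theorem atMostOneInvariant_of_not_isRenormalizable (hp : p ∈ extRegion)
    (h : ¬ IsRenormalizable p) (haper : IsAperiodic (extMap p hp)) :
    AtMostOneInvariant (extMap p hp) := by
  revert haper
  refine induction_of_not_isRenormalizable
    (P := fun p hp => IsAperiodic (extMap p hp) → AtMostOneInvariant (extMap p hp)) ?_ ?_ hp h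
  · intro p hp hp'
    obtain ⟨L, h1, h2, h3⟩ := exists_translation_modulus hp hp'
    exact atMostOneInvariant_of_translation hp h1 h2 h3
  · exact fun p hp ih haper => atMostOneInvariant_of_gauss hp (ih (isAperiodic_gauss hp haper))

theorem AtMostOneInvariant.encard_ergodicMeasures_le {T : I → I} (h : AtMostOneInvariant T) :
    (ergodicMeasures T).encard ≤ 1 := by
  rw [encard_le_one_iff]
  rintro μ ν ⟨hμ, hμe⟩ ⟨hν, hνe⟩
  exact h μ ν hμ hν hμe.toMeasurePreserving hνe.toMeasurePreserving

end TranslationMap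

end

theorem corollary2p14 (p : ℝ × ℝ) (hp : p ∈ TranslationMap.paramRegion) :
    ((TranslationMap.IsAperiodic (TranslationMap.itm p hp) ∨
        ¬ TranslationMap.IsFiniteType (TranslationMap.itm p hp)) →
      (TranslationMap.ergodicMeasures (TranslationMap.itm p hp)).encard ≤ 2) ∧
    (¬ TranslationMap.IsFiniteType (TranslationMap.itm p hp) →
      (Set.extremePoints ℝ (TranslationMap.limitSet p)).encard ≤ 2 ∧
      Set.BijOn (TranslationMap.freqVector p)
        (TranslationMap.ergodicMeasures (TranslationMap.itm p hp))
        (Set.extremePoints ℝ (TranslationMap.limitSet p))) := by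
  by_cases h : TranslationMap.IsRenormalizable p
  · have hbij := h.bijOn_freqVector
    have hle := h.encard_extremePoints_le
    refine ⟨fun _ => ?_, fun _ => ⟨hle, hbij⟩⟩
    rwa [← hbij.image_eq, hbij.injOn.encard_image] at hle
  · have hfin := TranslationMap.isFiniteType_of_not_isRenormalizable
      (TranslationMap.paramRegion_subset hp) h
    refine ⟨fun haper => ?_, fun hinf => absurd hfin hinf⟩
    have haper' := haper.resolve_right (not_not.2 hfin)
    exact (TranslationMap.atMostOneInvariant_of_not_isRenormalizable
      (TranslationMap.paramRegion_subset hp) h haper').encard_ergodicMeasures_le.trans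
        (by norm_num)
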